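/- Let $M$ be a closed (compact, without boundary) smooth surface, let $p\ge 0$, $N=p+2$, and let $F:M\to\mathbb{S}^N$ be a smooth minimal immersion into the unit sphere such that the induced metric has positive Gaussian curvature. Over any open set $U\subset M$, let $e_1,e_2$ and $\nu_3,\dots,\nu_N$ be smooth orthonormal frames of the tangent and of the normal bundle of $M$ in $\mathbb{S}^N$, let $h^\alpha_{ij}$ be the components of the second fundamental form $h$, and let $h^\alpha_{ijk}$, $h^\alpha_{ijkl}$, $h^\alpha_{ijklm}$ be the components of its covariant derivatives $\nabla h,\nabla^2h,\nabla^3h$ (with respect to the Levi-Civita and the normal connection, each new index being the direction of differentiation). Let $S=|h|^2=\sum_{i,j,\alpha}(h^\alpha_{ij})^2$ and $a_{ijk}=(h^\alpha_{11ijk})_{\alpha}\in\mathbb{R}^p$, and put $$\mathcal{C}_2=2|a_{111}-a_{122}|^2+2|a_{211}-a_{222}|^2,\qquad \mathcal{C}_3=2|a_{112}+a_{121}|^2+2|a_{212}+a_{221}|^2 .$$ Then, at every point of $U$, $$\mathcal{C}_2+\mathcal{C}_3\ \ge\ \frac{9}{8}\,S\,|\nabla S|^2 .$$ -/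

import Mathlib

open Metric Set
open scoped Manifold ContDiff InnerProductSpace

namespace MinimalSurface

/-- The Euclidean space `ℝ^{p+3}`, which contains the unit sphere `𝕊^{p+2}`. -/
abbrev Ambient (p : ℕ) : Type := EuclideanSpace ℝ (Fin (p + 2 + 1))

/-- The unit sphere `𝕊^N` with `N = p + 2`. -/
abbrev UnitSphere (p : ℕ) : Type := sphere (0 : Ambient p) 1

noncomputable section

variable {M : Type*} [TopologicalSpace M] [ChartedSpace (EuclideanSpace ℝ (Fin 2)) M]
  [IsManifold (𝓡 2) ∞ M] {p : ℕ}

/-- The derivative `X f` at `x` of a function `f` with values in a normed space, in the direction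
of the tangent vector `X` at `x`. -/
def dirDeriv {V : Type*} [NormedAddCommGroup V] [NormedSpace ℝ V]
    (f : M → V) (x : M) (X : TangentSpace (𝓡 2) x) : V :=
  mfderiv (𝓡 2) 𝓘(ℝ, V) f x X

/-- The map `F : M → 𝕊^{p+2}` read as a map into `ℝ^{p+3}`. -/
def position (F : M → UnitSphere p) (x : M) : Ambient p := (F x : Ambient p)

/-- A smooth immersion of the surface `M` into the unit sphere `𝕊^{p+2}`. -/
def IsSmoothImmersion (F : M → UnitSphere p) : Prop :=
  ContMDiff (𝓡 2) (𝓡 (p + 2)) ∞ F ∧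
    ∀ x, Function.Injective (mfderiv (𝓡 2) (𝓡 (p + 2)) F x)

/-- The normal space of `F` at `x` in `T_{F(x)} 𝕊^{p+2}`: all vectors of `ℝ^{p+3}` orthogonal to
the position vector `F x` and to the tangent vectors `dF(X)`. -/
def normalSpace (F : M → UnitSphere p) (x : M) : Submodule ℝ (Ambient p) :=
  (Submodule.span ℝ ({position F x} ∪ Set.range (dirDeriv (position F) x)))ᗮ

/-- A smooth local frame `(e₁, e₂)` of `TM` over an open set `U`, orthonormal for the metric
induced by `F`. The indices `1, 2` are written `0, 1`. -/
structure TangentFrame (F : M → UnitSphere p) (U : Set M) where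
  isOpen : IsOpen U
  /-- The tangent vector fields; only their values on `U` matter. -/
  e : Fin 2 → (x : M) → TangentSpace (𝓡 2) x
  smooth_e : ∀ i, ContMDiffOn (𝓡 2) ((𝓡 2).prod 𝓘(ℝ, EuclideanSpace ℝ (Fin 2))) ∞
    (fun x => (⟨x, e i x⟩ : TangentBundle (𝓡 2) M)) U
  orthonormal_e : ∀ x ∈ U, Orthonormal ℝ (fun i => dirDeriv (position F) x (e i x))

namespace TangentFrame

variable {F : M → UnitSphere p} {U : Set M} (fr : TangentFrame F U)

/-- The frame vector `e_i`, read as the vector `dF(e_i)` of `ℝ^{p+3}`. -/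
def vec (i : Fin 2) (x : M) : Ambient p := dirDeriv (position F) x (fr.e i x)

/-- `fr.conn i j x X` is the value `ω_{ij}(X) = ⟨D_X e_i, e_j⟩` at `x` of the connection form of the
induced metric; `∇_X e_i = ω_{ij}(X) e_j` is the tangential part of the derivative `D` of
`ℝ^{p+3}`. -/
def conn (i j : Fin 2) (x : M) (X : TangentSpace (𝓡 2) x) : ℝ :=
  ⟪dirDeriv (fr.vec i) x X, fr.vec j x⟫_ℝ

/-- The Gaussian curvature `K` of the induced metric, given by the structure equation
`dω₁₂ = - K ω₁ ∧ ω₂`, that is, `K = - dω₁₂(e₁, e₂)` with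
`dω₁₂(e₁, e₂) = e₁(ω₁₂(e₂)) - e₂(ω₁₂(e₁)) - ω₁₂([e₁, e₂])`. -/
def gaussCurvature (x : M) : ℝ :=
  -(dirDeriv (fun y => fr.conn 0 1 y (fr.e 1 y)) x (fr.e 0 x)
    - dirDeriv (fun y => fr.conn 0 1 y (fr.e 0 y)) x (fr.e 1 x)
    - fr.conn 0 1 x (VectorField.mlieBracket (𝓡 2) (fr.e 0) (fr.e 1) x))

/-- The mean curvature normal vector `H`, given by `2H = ∑ᵢ h(e_i, e_i)`, where `h(e_i, e_i)` is
the component of `D_{e_i} e_i` in the normal space. -/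
def meanCurvature (x : M) : Ambient p :=
  (1 / 2 : ℝ) • ∑ i, (normalSpace F x).starProjection (dirDeriv (fr.vec i) x (fr.e i x))

end TangentFrame

/-- `F` is minimal: its mean curvature normal vector field vanishes identically. -/
def IsMinimal (F : M → UnitSphere p) : Prop :=
  ∀ (U : Set M) (fr : TangentFrame F U), ∀ x ∈ U, fr.meanCurvature x = 0

/-- The metric induced by `F` has positive Gaussian curvature everywhere. -/
def HasPositiveGaussCurvature (F : M → UnitSphere p) : Prop :=
  ∀ (U : Set M) (fr : TangentFrame F U), ∀ x ∈ U, 0 < fr.gaussCurvature x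

/-- A smooth local orthonormal frame `(e₁, e₂, ν_α)` of `T𝕊^{p+2}` along `F` over an open set `U`,
adapted to `F`: `e₁, e₂` are tangent and the `ν_α` are normal. -/
structure AdaptedFrame (F : M → UnitSphere p) (U : Set M) extends TangentFrame F U where
  /-- The normal vector fields; only their values on `U` matter. -/
  ν : Fin p → M → Ambient p
  smooth_ν : ∀ α, ContMDiffOn (𝓡 2) 𝓘(ℝ, Ambient p) ∞ (ν α) U
  orthonormal_ν : ∀ x ∈ U, Orthonormal ℝ (fun α => ν α x)
  normal_ν : ∀ x ∈ U, ∀ α, ν α x ∈ normalSpace F x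

namespace AdaptedFrame

variable {F : M → UnitSphere p} {U : Set M} (fr : AdaptedFrame F U)

/-- The derivative `e_k(f)` of a function `f`. -/
def D (k : Fin 2) (f : M → ℝ) (x : M) : ℝ := dirDeriv f x (fr.e k x)

/-- The tangential connection coefficients `ω_{ij}(e_k)`. -/
def connT (i j k : Fin 2) (x : M) : ℝ := fr.conn i j x (fr.e k x)

/-- The normal connection coefficients `ω_{βα}(e_k) = ⟨D_{e_k} ν_β, ν_α⟩`. -/
def connN (β α : Fin p) (k : Fin 2) (x : M) : ℝ :=
  ⟪dirDeriv (fr.ν β) x (fr.e k x), fr.ν α x⟫_ℝ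

/-- The second fundamental form `h^α_{ij} = ω_{iα}(e_j) = ⟨D_{e_j} e_i, ν_α⟩`. -/
def h (α : Fin p) (i j : Fin 2) (x : M) : ℝ :=
  ⟪dirDeriv (fr.vec i) x (fr.e j x), fr.ν α x⟫_ℝ

/-- The components `h^α_{ijk}` of the covariant derivative `∇h`. -/
def h₁ (α : Fin p) (i j k : Fin 2) (x : M) : ℝ :=
  fr.D k (fr.h α i j) x
    + ∑ m, fr.h α m j x * fr.connT m i k x
    + ∑ m, fr.h α i m x * fr.connT m j k x
    + ∑ β, fr.h β i j x * fr.connN β α k x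

/-- The components `h^α_{ijkl}` of the second covariant derivative `∇²h`. -/
def h₂ (α : Fin p) (i j k l : Fin 2) (x : M) : ℝ :=
  fr.D l (fr.h₁ α i j k) x
    + ∑ m, fr.h₁ α m j k x * fr.connT m i l x
    + ∑ m, fr.h₁ α i m k x * fr.connT m j l x
    + ∑ m, fr.h₁ α i j m x * fr.connT m k l x
    + ∑ β, fr.h₁ β i j k x * fr.connN β α l x

/-- The components `h^α_{ijklm}` of the third covariant derivative `∇³h`. -/
def h₃ (α : Fin p) (i j k l m : Fin 2) (x : M) : ℝ :=
  fr.D m (fr.h₂ α i j k l) x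
    + ∑ n, fr.h₂ α n j k l x * fr.connT n i m x
    + ∑ n, fr.h₂ α i n k l x * fr.connT n j m x
    + ∑ n, fr.h₂ α i j n l x * fr.connT n k m x
    + ∑ n, fr.h₂ α i j k n x * fr.connT n l m x
    + ∑ β, fr.h₂ β i j k l x * fr.connN β α m x

/-- The vector `a_{ijk} = (h^α_{11ijk})_α` of `ℝ^p`. -/
def a₃ (i j k : Fin 2) (x : M) : EuclideanSpace ℝ (Fin p) :=
  WithLp.toLp 2 (fun α => fr.h₃ α 0 0 i j k x)

/-- The squared norm `S = |h|²` of the second fundamental form. -/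
def S (x : M) : ℝ := ∑ α, ∑ i, ∑ j, fr.h α i j x ^ 2

/-- The squared norm `|∇S|²` of the gradient of `S` in the induced metric. -/
def gradSqS (x : M) : ℝ := ∑ k, fr.D k fr.S x ^ 2

/-- `𝒞₂ = 2|a₁₁₁ - a₁₂₂|² + 2|a₂₁₁ - a₂₂₂|²`. -/
def C₂ (x : M) : ℝ :=
  2 * ‖fr.a₃ 0 0 0 x - fr.a₃ 0 1 1 x‖ ^ 2 + 2 * ‖fr.a₃ 1 0 0 x - fr.a₃ 1 1 1 x‖ ^ 2

/-- `𝒞₃ = 2|a₁₁₂ + a₁₂₁|² + 2|a₂₁₂ + a₂₂₁|²`. -/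
def C₃ (x : M) : ℝ :=
  2 * ‖fr.a₃ 0 0 1 x + fr.a₃ 0 1 0 x‖ ^ 2 + 2 * ‖fr.a₃ 1 0 1 x + fr.a₃ 1 1 0 x‖ ^ 2

end AdaptedFrame

end

end MinimalSurface

namespace MinimalSurface
noncomputable section

open Filter Topology VectorField

/-! ### Differential calculus of vector-valued functions on the surface. -/

section Calculus

variable {M : Type*} [TopologicalSpace M] [ChartedSpace (EuclideanSpace ℝ (Fin 2)) M]
variable {V : Type*} [NormedAddCommGroup V] [NormedSpace ℝ V]
variable {V' : Type*} [NormedAddCommGroup V'] [NormedSpace ℝ V']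
variable {H : Type*} [NormedAddCommGroup H] [InnerProductSpace ℝ H]

/-! Write `A`, `B` for the normal vectors h(e₁,e₁), h(e₁,e₂). By minimality they determine h, and by
the Codazzi equations the quartic form with coefficient |A|² - |B|² and 2⟨A,B⟩ is holomorphic up to
sign conventions (`deriv_hopf_zero`, `deriv_hopf_one`). If its squared length were nonzero at a
maximum, the Cauchy-Riemann equations would force its covariant derivative to vanish there, and the
Laplacian of the squared length would be 8K times that length, positive since K > 0: a contradiction
(`hopfSq_eq_zero_of_isLocalMax`). The squared length does not depend on the frame (`hopfSq_eq`), so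
it is a continuous function on the compact M and vanishes identically: |A| = |B| and A ⊥ B
everywhere.

For such surfaces Simons' identity becomes linear in h up to a scalar: Δh = (2 - 3S/2)h. By Codazzi
and trace-freeness, Δh₁₁ = h₁₁₁₁ + h₁₁₂₂ and Δh₁₂ = h₁₁₂₁ - h₁₁₁₂ are commutators of second
derivatives, hence pure curvature terms (`h₂_zero_zero_add`, `h₂_zero_zero_sub`). Differentiating in
the direction e_m gives, with c = 2 - 3S/2, a₁₁ₘ + a₂₂ₘ = c h₁₁ₘ - (3/2) Sₘ h₁₁ and a₂₁ₘ - a₁₂ₘ = c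
h₁₂ₘ - (3/2) Sₘ h₁₂.

In (a₁₁₁ - a₁₂₂) + (a₂₁₂ + a₂₂₁) and (a₂₁₁ - a₂₂₂) - (a₁₁₂ + a₁₂₁) the terms with c cancel by
Codazzi, leaving -(3/2)(S₁h₁₁ + S₂h₁₂) and -(3/2)(S₁h₁₂ - S₂h₁₁). Since 2|X|² + 2|Y|² ≥ |X ± Y|²,
the left side is at least (9/4)|∇S|²(|A|² + |B|²), and |A|² + |B|² = S/2. -/

lemma dirDeriv_congr {f g : M → V} {x : M} (h : f =ᶠ[𝓝 x] g) (X : TangentSpace (𝓡 2) x) :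
    dirDeriv f x X = dirDeriv g x X := by
  unfold dirDeriv
  rw [h.mfderiv_eq]; rfl

lemma dirDeriv_const (c : V) (x : M) (X : TangentSpace (𝓡 2) x) :
    dirDeriv (fun _ => c) x X = 0 := by
  unfold dirDeriv
  rw [mfderiv_const]; rfl

lemma dirDeriv_add {f g : M → V} {x : M} (hf : MDifferentiableAt (𝓡 2) 𝓘(ℝ, V) f x)
    (hg : MDifferentiableAt (𝓡 2) 𝓘(ℝ, V) g x) (X : TangentSpace (𝓡 2) x) :
    dirDeriv (fun y => f y + g y) x X = dirDeriv f x X + dirDeriv g x X :=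
  congrArg (fun L => L X) (mvfderiv_fun_add hf hg)

lemma dirDeriv_sub {f g : M → V} {x : M} (hf : MDifferentiableAt (𝓡 2) 𝓘(ℝ, V) f x)
    (hg : MDifferentiableAt (𝓡 2) 𝓘(ℝ, V) g x) (X : TangentSpace (𝓡 2) x) :
    dirDeriv (fun y => f y - g y) x X = dirDeriv f x X - dirDeriv g x X :=
  congrArg (fun L => L X) (mvfderiv_fun_sub hf hg)

lemma dirDeriv_neg {f : M → V} {x : M} (X : TangentSpace (𝓡 2) x) :
    dirDeriv (fun y => - f y) x X = - dirDeriv f x X :=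
  congrArg (fun L => L X) (mvfderiv_fun_neg (g := f))

lemma dirDeriv_smul {a : M → ℝ} {f : M → V} {x : M}
    (ha : MDifferentiableAt (𝓡 2) 𝓘(ℝ, ℝ) a x)
    (hf : MDifferentiableAt (𝓡 2) 𝓘(ℝ, V) f x) (X : TangentSpace (𝓡 2) x) :
    dirDeriv (fun y => a y • f y) x X = a x • dirDeriv f x X + dirDeriv a x X • f x :=
  congrArg (fun L => L X) (mvfderiv_fun_smul ha hf)

lemma dirDeriv_mul {a b : M → ℝ} {x : M}
    (ha : MDifferentiableAt (𝓡 2) 𝓘(ℝ, ℝ) a x)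
    (hb : MDifferentiableAt (𝓡 2) 𝓘(ℝ, ℝ) b x) (X : TangentSpace (𝓡 2) x) :
    dirDeriv (fun y => a y * b y) x X = a x * dirDeriv b x X + dirDeriv a x X * b x :=
  dirDeriv_smul ha hb X

lemma dirDeriv_const_mul (c : ℝ) {b : M → ℝ} {x : M}
    (hb : MDifferentiableAt (𝓡 2) 𝓘(ℝ, ℝ) b x) (X : TangentSpace (𝓡 2) x) :
    dirDeriv (fun y => c * b y) x X = c * dirDeriv b x X := by
  rw [dirDeriv_mul mdifferentiableAt_const hb, dirDeriv_const]; ring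

lemma dirDeriv_comp {L : V → V'} {f : M → V} {x : M} (hL : DifferentiableAt ℝ L (f x))
    (hf : MDifferentiableAt (𝓡 2) 𝓘(ℝ, V) f x) (X : TangentSpace (𝓡 2) x) :
    dirDeriv (fun y => L (f y)) x X = fderiv ℝ L (f x) (dirDeriv f x X) := by
  unfold dirDeriv
  have := mfderiv_comp (I := 𝓡 2) (I' := 𝓘(ℝ, V)) (I'' := 𝓘(ℝ, V')) x hL.mdifferentiableAt hf
  rw [mfderiv_eq_fderiv] at this
  exact congrArg (fun L => L X) this

lemma dirDeriv_inner {f g : M → H} {x : M}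
    (hf : MDifferentiableAt (𝓡 2) 𝓘(ℝ, H) f x) (hg : MDifferentiableAt (𝓡 2) 𝓘(ℝ, H) g x)
    (X : TangentSpace (𝓡 2) x) :
    dirDeriv (fun y => ⟪f y, g y⟫_ℝ) x X
      = ⟪dirDeriv f x X, g x⟫_ℝ + ⟪f x, dirDeriv g x X⟫_ℝ := by
  have h1 : HasFDerivAt (fun q : H × H => ⟪q.1, q.2⟫_ℝ) _ (f x, g x) :=
    HasFDerivAt.inner ℝ hasFDerivAt_fst hasFDerivAt_snd
  have hfg := hf.prodMk_space hg
  have h2 := dirDeriv_comp (f := fun y => (f y, g y)) (x := x) h1.differentiableAt hfg X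
  have h3 := dirDeriv_comp (f := fun y => (f y, g y)) (x := x) (L := Prod.fst) differentiableAt_fst hfg X
  have h4 := dirDeriv_comp (f := fun y => (f y, g y)) (x := x) (L := Prod.snd) differentiableAt_snd hfg X
  rw [fderiv_fst] at h3
  rw [fderiv_snd] at h4
  rw [h1.fderiv] at h2
  refine h2.trans ?_
  change ⟪f x, (dirDeriv (fun y => (f y, g y)) x X).2⟫_ℝ
    + ⟪(dirDeriv (fun y => (f y, g y)) x X).1, g x⟫_ℝ = _
  change dirDeriv f x X = (dirDeriv (fun y => (f y, g y)) x X).1 at h3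
  change dirDeriv g x X = (dirDeriv (fun y => (f y, g y)) x X).2 at h4
  rw [h3, h4, add_comm]

lemma dirDeriv_apply_add (f : M → V) (x : M) (X Y : TangentSpace (𝓡 2) x) :
    dirDeriv f x (X + Y) = dirDeriv f x X + dirDeriv f x Y := map_add _ _ _

lemma dirDeriv_apply_smul (f : M → V) (x : M) (c : ℝ) (X : TangentSpace (𝓡 2) x) :
    dirDeriv f x (c • X) = c • dirDeriv f x X := map_smul _ _ _

lemma dirDeriv_apply_zero (f : M → V) (x : M) :
    dirDeriv f x (0 : TangentSpace (𝓡 2) x) = 0 := map_zero _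

lemma eventuallyEq_comp_extChartAt {Z : Type*} (f : M → Z) {x y : M}
    (hy : y ∈ (extChartAt (𝓡 2) x).source) :
    f =ᶠ[𝓝 y] fun z => (f ∘ (extChartAt (𝓡 2) x).symm) (extChartAt (𝓡 2) x z) := by
  filter_upwards [(isOpen_extChartAt_source x).mem_nhds hy] with z hz
  exact (congrArg f ((extChartAt (𝓡 2) x).left_inv hz)).symm

lemma contDiffAt_comp_extChartAt_symm {n : ℕ∞ω} {f : M → V} {x : M}
    (hf : ContMDiffAt (𝓡 2) 𝓘(ℝ, V) n f x) :
    ContDiffAt ℝ n (f ∘ (extChartAt (𝓡 2) x).symm) (extChartAt (𝓡 2) x x) := by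
  have := (contMDiffAt_iff.1 hf).2
  rwa [ModelWithCorners.Boundaryless.range_eq_univ, contDiffWithinAt_univ] at this

lemma isLocalMax_comp_extChartAt_symm {f : M → ℝ} {x : M} (hmax : IsLocalMax f x) :
    IsLocalMax (f ∘ (extChartAt (𝓡 2) x).symm) (extChartAt (𝓡 2) x x) := by
  have hc : Tendsto (extChartAt (𝓡 2) x).symm (𝓝 (extChartAt (𝓡 2) x x)) (𝓝 x) := by
    have := continuousAt_extChartAt_symm (I := 𝓡 2) x
    rwa [ContinuousAt, extChartAt_to_inv] at this
  filter_upwards [hc.eventually hmax] with y hy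
  simpa only [Function.comp, extChartAt_to_inv] using hy

variable [IsManifold (𝓡 2) ∞ M]

lemma contMDiffOn_dirDeriv {f : M → V} {U : Set M} (hU : IsOpen U)
    {e : (x : M) → TangentSpace (𝓡 2) x}
    (hf : ContMDiffOn (𝓡 2) 𝓘(ℝ, V) ∞ f U)
    (he : ContMDiffOn (𝓡 2) ((𝓡 2).prod 𝓘(ℝ, EuclideanSpace ℝ (Fin 2))) ∞
      (fun x => (⟨x, e x⟩ : TangentBundle (𝓡 2) M)) U) :
    ContMDiffOn (𝓡 2) 𝓘(ℝ, V) ∞ (fun x => dirDeriv f x (e x)) U := by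
  have h1 := hf.contMDiffOn_tangentMapWithin (m := ∞) (by simp) hU.uniqueMDiffOn
  have h2 := h1.comp he (fun x hx => hx)
  have h3 := (contMDiff_snd_tangentBundle_modelSpace (n := ∞) V 𝓘(ℝ, V)).comp_contMDiffOn h2
  refine h3.congr fun x hx => ?_
  change mfderiv (𝓡 2) 𝓘(ℝ, V) f x (e x) = mfderivWithin (𝓡 2) 𝓘(ℝ, V) f U x (e x)
  rw [mfderivWithin_of_isOpen hU hx]

/-- A vector field on a surface read in the chart at `x`. -/
def chartField (x : M) (X : (x : M) → TangentSpace (𝓡 2) x) :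
    EuclideanSpace ℝ (Fin 2) → EuclideanSpace ℝ (Fin 2) := fun y =>
  mpullbackWithin 𝓘(ℝ, EuclideanSpace ℝ (Fin 2)) (𝓡 2) (extChartAt (𝓡 2) x).symm X
    (range (𝓡 2)) y

/-- A vector field read in a chart is the image of the field under the differential of the
chart. -/
lemma mfderiv_extChartAt_apply_eq {x y : M} (hy : y ∈ (extChartAt (𝓡 2) x).source)
    (X : (x : M) → TangentSpace (𝓡 2) x) :
    mfderiv (𝓡 2) 𝓘(ℝ, EuclideanSpace ℝ (Fin 2)) (extChartAt (𝓡 2) x) y (X y) =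
      chartField x X (extChartAt (𝓡 2) x y) := by
  rw [chartField, mpullbackWithin_apply]
  have h1 := mfderivWithin_extChartAt_symm_comp_mfderiv_extChartAt' (I := 𝓡 2) hy
  have h2 := isInvertible_mfderivWithin_extChartAt_symm (I := 𝓡 2)
    ((extChartAt (𝓡 2) x).map_source hy)
  have h3 : (X ((extChartAt (𝓡 2) x).symm (extChartAt (𝓡 2) x y)) : EuclideanSpace ℝ (Fin 2))
      = X y := congrArg (fun z => (X z : EuclideanSpace ℝ (Fin 2)))
        ((extChartAt (𝓡 2) x).left_inv hy)
  symm
  rw [h2.inverse_apply_eq]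
  refine h3.trans ?_
  exact (congrArg (fun L => L (X y)) h1).symm

/-- The directional derivative of a function read in a chart. -/
lemma dirDeriv_comp_extChartAt {x y : M} (hy : y ∈ (extChartAt (𝓡 2) x).source)
    {g : EuclideanSpace ℝ (Fin 2) → V} (hg : DifferentiableAt ℝ g (extChartAt (𝓡 2) x y))
    (X : (x : M) → TangentSpace (𝓡 2) x) :
    dirDeriv (fun z => g (extChartAt (𝓡 2) x z)) y (X y) = fderiv ℝ g (extChartAt (𝓡 2) x y)
      (chartField x X (extChartAt (𝓡 2) x y)) := by
  rw [← mfderiv_extChartAt_apply_eq hy]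
  exact dirDeriv_comp hg (mdifferentiableAt_extChartAt (by simpa using hy)) (X y)

/-- The second derivative of `f` along `V` then `W`, in a chart. -/
lemma dirDeriv_dirDeriv_eq_chart {f : M → V} {x : M} {X Y : (x : M) → TangentSpace (𝓡 2) x}
    (hf : ContMDiffAt (𝓡 2) 𝓘(ℝ, V) 2 f x)
    (hY : MDifferentiableAt (𝓡 2) ((𝓡 2).prod 𝓘(ℝ, EuclideanSpace ℝ (Fin 2)))
      (fun x => (⟨x, Y x⟩ : TangentBundle (𝓡 2) M)) x) :
    dirDeriv (fun y => dirDeriv f y (Y y)) x (X x) =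
      fderiv ℝ (fderiv ℝ (f ∘ (extChartAt (𝓡 2) x).symm)) (extChartAt (𝓡 2) x x)
        (chartField x X (extChartAt (𝓡 2) x x))
        (chartField x Y (extChartAt (𝓡 2) x x)) +
      fderiv ℝ (f ∘ (extChartAt (𝓡 2) x).symm) (extChartAt (𝓡 2) x x)
        (fderiv ℝ (chartField x Y) (extChartAt (𝓡 2) x x)
        (chartField x X (extChartAt (𝓡 2) x x))) := by
  set φ := extChartAt (𝓡 2) x with hφ
  set Y' := chartField x Y with hY'def
  have hf' : ContDiffAt ℝ 2 (f ∘ φ.symm) (φ x) := contDiffAt_comp_extChartAt_symm hf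
  have hY' : DifferentiableAt ℝ Y' (φ x) := by
    have : DifferentiableWithinAt ℝ (chartField x Y) (φ.symm ⁻¹' univ ∩ range (𝓡 2)) (φ x) :=
      MDifferentiableWithinAt.differentiableWithinAt_mpullbackWithin_vectorField
        (s := univ) hY.mdifferentiableWithinAt
    rwa [preimage_univ, univ_inter, ModelWithCorners.Boundaryless.range_eq_univ,
      differentiableWithinAt_univ] at this
  have hd : DifferentiableAt ℝ (fderiv ℝ (f ∘ φ.symm)) (φ x) :=
    (hf'.fderiv_right (m := 1) (by norm_num)).differentiableAt (by norm_num)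
  have hev : ∀ᶠ z in 𝓝 x, DifferentiableAt ℝ (f ∘ φ.symm) (φ z) :=
    (continuousAt_extChartAt (I := 𝓡 2) x).eventually <|
      (hf'.eventually (by simp)).mono fun z hz => hz.differentiableAt (by norm_num)
  have h1 : (fun y => dirDeriv f y (Y y)) =ᶠ[𝓝 x]
      fun y => (fun z => fderiv ℝ (f ∘ φ.symm) z (Y' z)) (φ y) := by
    filter_upwards [hev, (isOpen_extChartAt_source (I := 𝓡 2) x).mem_nhds (mem_extChartAt_source (I := 𝓡 2) x)]
      with y hy hys
    rw [dirDeriv_congr (eventuallyEq_comp_extChartAt f hys)]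
    exact dirDeriv_comp_extChartAt hys hy Y
  rw [dirDeriv_congr h1, dirDeriv_comp_extChartAt (mem_extChartAt_source x) (hd.clm_apply hY'),
    fderiv_clm_apply hd hY', add_comm]
  rfl

/-- In a chart the iterated derivative splits into a Hessian term, which is symmetric and cancels,
and a first-order term whose antisymmetrization is the bracket. The values lie in any normed space,
so this applies to maps into ℝ^{p+3} and expresses the flatness of that space. -/
lemma dirDeriv_mlieBracket {f : M → V} {x : M} {X Y : (x : M) → TangentSpace (𝓡 2) x}
    (hf : ContMDiffAt (𝓡 2) 𝓘(ℝ, V) 2 f x)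
    (hX : MDifferentiableAt (𝓡 2) ((𝓡 2).prod 𝓘(ℝ, EuclideanSpace ℝ (Fin 2)))
      (fun x => (⟨x, X x⟩ : TangentBundle (𝓡 2) M)) x)
    (hY : MDifferentiableAt (𝓡 2) ((𝓡 2).prod 𝓘(ℝ, EuclideanSpace ℝ (Fin 2)))
      (fun x => (⟨x, Y x⟩ : TangentBundle (𝓡 2) M)) x) :
    dirDeriv f x (mlieBracket (𝓡 2) X Y x) =
      dirDeriv (fun y => dirDeriv f y (Y y)) x (X x)
        - dirDeriv (fun y => dirDeriv f y (X y)) x (Y x) := by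
  have hf' : ContDiffAt ℝ 2 (f ∘ (extChartAt (𝓡 2) x).symm) (extChartAt (𝓡 2) x x) :=
    contDiffAt_comp_extChartAt_symm hf
  have hsymm := (hf'.isSymmSndFDerivAt (by simp)).eq
    (chartField x X (extChartAt (𝓡 2) x x))
    (chartField x Y (extChartAt (𝓡 2) x x))
  rw [dirDeriv_dirDeriv_eq_chart hf hY, dirDeriv_dirDeriv_eq_chart hf hX, hsymm,
    add_sub_add_left_eq_sub, ← map_sub, dirDeriv_congr
      (eventuallyEq_comp_extChartAt f (mem_extChartAt_source (I := 𝓡 2) x)),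
    dirDeriv_comp_extChartAt (mem_extChartAt_source x) (hf'.differentiableAt (by norm_num))
      (mlieBracket (𝓡 2) X Y), ← mfderiv_extChartAt_apply_eq (mem_extChartAt_source x)]
  congr 1
  rw [← mlieBracketWithin_univ, mlieBracketWithin_apply, preimage_univ, univ_inter]
  refine ((isInvertible_mfderiv_extChartAt (mem_extChartAt_source x)).self_apply_inverse _).trans ?_
  change lieBracketWithin ℝ (chartField x X) (chartField x Y) (range (𝓡 2)) _ = _
  rw [ModelWithCorners.Boundaryless.range_eq_univ, lieBracketWithin_univ]
  rfl

lemma dirDeriv_eq_zero_of_isLocalMax {f : M → ℝ} {x : M}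
    (hf : ContMDiffAt (𝓡 2) 𝓘(ℝ, ℝ) 2 f x) (hmax : IsLocalMax f x) (X : TangentSpace (𝓡 2) x) :
    dirDeriv f x X = 0 := by
  rw [dirDeriv_congr (eventuallyEq_comp_extChartAt f (mem_extChartAt_source (I := 𝓡 2) x))]
  refine (dirDeriv_comp ((contDiffAt_comp_extChartAt_symm hf).differentiableAt (by norm_num))
    (mdifferentiableAt_extChartAt (mem_chart_source _ x)) X).trans ?_
  rw [(isLocalMax_comp_extChartAt_symm hmax).fderiv_eq_zero]; rfl

/-- The second derivative test: at a local maximum, `X X f ≤ 0`. -/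
lemma dirDeriv_dirDeriv_nonpos_of_isLocalMax {f : M → ℝ} {x : M}
    {X : (x : M) → TangentSpace (𝓡 2) x}
    (hf : ContMDiffAt (𝓡 2) 𝓘(ℝ, ℝ) 2 f x)
    (hX : MDifferentiableAt (𝓡 2) ((𝓡 2).prod 𝓘(ℝ, EuclideanSpace ℝ (Fin 2)))
      (fun x => (⟨x, X x⟩ : TangentBundle (𝓡 2) M)) x) (hmax : IsLocalMax f x) :
    dirDeriv (fun y => dirDeriv f y (X y)) x (X x) ≤ 0 := by
  have hf' : ContDiffAt ℝ 2 (f ∘ (extChartAt (𝓡 2) x).symm) (extChartAt (𝓡 2) x x) :=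
    contDiffAt_comp_extChartAt_symm hf
  set φ := extChartAt (𝓡 2) x with hφ
  have hd : DifferentiableAt ℝ (fderiv ℝ (f ∘ φ.symm)) (φ x) :=
    (hf'.fderiv_right (m := 1) (by norm_num)).differentiableAt (by norm_num)
  have hmax' : IsLocalMax (f ∘ φ.symm) (φ x) := isLocalMax_comp_extChartAt_symm hmax
  rw [dirDeriv_dirDeriv_eq_chart hf hX, hmax'.fderiv_eq_zero, zero_apply,
    add_zero]
  set v := chartField x X (φ x)
  by_contra! hpos
  -- Restriction to the line through the point in the direction of the field: a positive second
  -- derivative would make 0 a local minimum as well as a local maximum, so `u` would be locally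
  -- constant.
  set l : ℝ → EuclideanSpace ℝ (Fin 2) := fun t => φ x + t • v with hl
  have hl0 : l 0 = φ x := by simp [hl]
  have hld : ∀ t, HasDerivAt l v t := fun t => by
    have := ((hasDerivAt_id t).smul_const v).const_add (φ x)
    rwa [one_smul] at this
  have hlc : Tendsto l (𝓝 0) (𝓝 (φ x)) := hl0 ▸ (hld 0).continuousAt
  set u : ℝ → ℝ := fun t => (f ∘ φ.symm) (l t) with hu
  have hud : ∀ᶠ t in 𝓝 0, deriv u t = fderiv ℝ (f ∘ φ.symm) (l t) v := by
    filter_upwards [hlc.eventually (hf'.eventually (by simp))] with t ht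
    exact ((ht.differentiableAt (by norm_num)).hasFDerivAt.comp_hasDerivAt t (hld t)).deriv
  have hu0 : deriv u 0 = 0 := by
    rw [hud.self_of_nhds, hl0, hmax'.fderiv_eq_zero]; rfl
  have hudd : deriv (deriv u) 0 = fderiv ℝ (fderiv ℝ (f ∘ φ.symm)) (φ x) v v := by
    rw [EventuallyEq.deriv_eq hud]
    rw [← hl0] at hd
    have h1 := hd.hasFDerivAt.comp_hasDerivAt 0 (hld 0)
    rw [hl0] at h1
    exact (h1.clm_apply (hasDerivAt_const _ v)).deriv.trans (by simp)
  have huc : ContinuousAt u 0 := by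
    have : ContinuousAt (f ∘ φ.symm) (l 0) := hl0 ▸ hf'.continuousAt
    exact this.comp (hld 0).continuousAt
  have hmin := isLocalMin_of_deriv_deriv_pos (hudd ▸ hpos) hu0 huc
  have hmaxu : ∀ᶠ t in 𝓝 0, u t ≤ u 0 := by
    filter_upwards [hlc.eventually hmax'] with t ht
    simpa only [hu, hl0] using ht
  have hconst : u =ᶠ[𝓝 0] fun _ => u 0 := by
    filter_upwards [hmin, hmaxu] with t h1 h2 using le_antisymm h2 h1
  have : deriv (deriv u) 0 = 0 := by
    rw [hconst.deriv.deriv_eq]; simp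
  exact hpos.ne' (hudd ▸ this)

end Calculus
end
end MinimalSurface

namespace MinimalSurface
noncomputable section

open Filter Topology VectorField

/-! ### Smooth functions on a subset, and the position vector. -/

section Smooth

variable {M : Type*} [TopologicalSpace M] [ChartedSpace (EuclideanSpace ℝ (Fin 2)) M]
variable {V : Type*} [NormedAddCommGroup V] [NormedSpace ℝ V]
variable {H : Type*} [NormedAddCommGroup H] [InnerProductSpace ℝ H]
variable {U : Set M}

/-- A smooth function on a subset of a surface, with values in a normed space. -/
abbrev SmoothOn (f : M → V) (U : Set M) : Prop := ContMDiffOn (𝓡 2) 𝓘(ℝ, V) ∞ f U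

lemma SmoothOn.add' {f g : M → V} (hf : SmoothOn f U) (hg : SmoothOn g U) :
    SmoothOn (fun x => f x + g x) U := ContMDiffOn.add hf hg

lemma SmoothOn.sub' {f g : M → V} (hf : SmoothOn f U) (hg : SmoothOn g U) :
    SmoothOn (fun x => f x - g x) U := ContMDiffOn.sub hf hg

lemma SmoothOn.neg' {f : M → V} (hf : SmoothOn f U) :
    SmoothOn (fun x => - f x) U := ContMDiffOn.neg hf

lemma SmoothOn.smul' {a : M → ℝ} {f : M → V} (ha : SmoothOn a U) (hf : SmoothOn f U) :
    SmoothOn (fun x => a x • f x) U := ContMDiffOn.smul ha hf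

lemma SmoothOn.mul' {a b : M → ℝ} (ha : SmoothOn a U) (hb : SmoothOn b U) :
    SmoothOn (fun x => a x * b x) U := ContMDiffOn.smul ha hb

lemma smoothOn_const (c : V) : SmoothOn (fun _ : M => c) U := contMDiffOn_const

lemma SmoothOn.inner' {f g : M → H} (hf : SmoothOn f U) (hg : SmoothOn g U) :
    SmoothOn (fun x => ⟪f x, g x⟫_ℝ) U :=
  (contDiff_inner (𝕜 := ℝ) (E := H)).contMDiff.comp_contMDiffOn (hf.prodMk_space hg)

lemma SmoothOn.sum' {ι : Type*} (s : Finset ι) {f : ι → M → V} (hf : ∀ i ∈ s, SmoothOn (f i) U) :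
    SmoothOn (fun x => ∑ i ∈ s, f i x) U := by
  classical
  induction s using Finset.induction_on with
  | empty => simpa using smoothOn_const (0 : V)
  | insert a s ha ih =>
    simp only [Finset.sum_insert ha]
    exact (hf a (by simp)).add' (ih fun i hi => hf i (by simp [hi]))

lemma SmoothOn.contMDiffAt' {f : M → V} (hU : IsOpen U) (hf : SmoothOn f U) {x : M} (hx : x ∈ U) :
    ContMDiffAt (𝓡 2) 𝓘(ℝ, V) ∞ f x := hf.contMDiffAt (hU.mem_nhds hx)

lemma SmoothOn.mdiff {f : M → V} (hU : IsOpen U) (hf : SmoothOn f U) {x : M} (hx : x ∈ U) :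
    MDifferentiableAt (𝓡 2) 𝓘(ℝ, V) f x := (hf.contMDiffAt' hU hx).mdifferentiableAt (by simp)

end Smooth

section Position

variable {M : Type*} [TopologicalSpace M] [ChartedSpace (EuclideanSpace ℝ (Fin 2)) M]
  [IsManifold (𝓡 2) ∞ M] {p : ℕ} {F : M → UnitSphere p}

omit [IsManifold (𝓡 2) ∞ M] in
lemma IsSmoothImmersion.contMDiff_position (hF : IsSmoothImmersion F) :
    ContMDiff (𝓡 2) 𝓘(ℝ, Ambient p) ∞ (position F) :=
  have : Fact (Module.finrank ℝ (Ambient p) = p + 2 + 1) := ⟨by simp⟩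
  (contMDiff_coe_sphere (m := ∞)).comp hF.1

omit [IsManifold (𝓡 2) ∞ M] in
lemma IsSmoothImmersion.dirDeriv_position_injective (hF : IsSmoothImmersion F) (x : M) :
    Function.Injective (dirDeriv (position F) x) := by
  have : Fact (Module.finrank ℝ (Ambient p) = p + 2 + 1) := ⟨by simp⟩
  have h1 : mfderiv (𝓡 2) 𝓘(ℝ, Ambient p) (position F) x = _ :=
    mfderiv_comp (I := 𝓡 2) (I' := 𝓡 (p + 2)) (I'' := 𝓘(ℝ, Ambient p)) x
      (g := ((↑) : UnitSphere p → Ambient p))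
      ((contMDiff_coe_sphere (m := ∞) (n := p + 2) (F x)).mdifferentiableAt (by simp))
      ((hF.1 x).mdifferentiableAt (by simp))
  intro X Y hXY
  have h2 : mfderiv (𝓡 2) 𝓘(ℝ, Ambient p) (position F) x X
    = mfderiv (𝓡 2) 𝓘(ℝ, Ambient p) (position F) x Y := hXY
  rw [h1] at h2
  exact hF.2 x (injective_mvfderiv_subtypeVal_sphere (F x) h2)

omit [IsManifold (𝓡 2) ∞ M] [TopologicalSpace M] [ChartedSpace (EuclideanSpace ℝ (Fin 2)) M] in
lemma inner_position_self (x : M) : ⟪position F x, position F x⟫_ℝ = 1 := by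
  rw [real_inner_self_eq_norm_sq]
  have : ‖position F x‖ = 1 := by simp [position]
  rw [this]; norm_num

end Position

/-! ### Moving frames: connection form, commutator and Gaussian curvature. -/

namespace TangentFrame

variable {M : Type*} [TopologicalSpace M] [ChartedSpace (EuclideanSpace ℝ (Fin 2)) M]
  [IsManifold (𝓡 2) ∞ M] {p : ℕ} {F : M → UnitSphere p} {U : Set M} (fr : TangentFrame F U)
variable {V : Type*} [NormedAddCommGroup V] [NormedSpace ℝ V]
variable {H : Type*} [NormedAddCommGroup H] [InnerProductSpace ℝ H]

/-- The derivative `e_k(f)` of a vector-valued function. -/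
def deriv (k : Fin 2) (f : M → V) (x : M) : V := dirDeriv f x (fr.e k x)

lemma smoothOn_deriv (k : Fin 2) {f : M → V} (hf : SmoothOn f U) : SmoothOn (fr.deriv k f) U :=
  contMDiffOn_dirDeriv fr.isOpen hf (fr.smooth_e k)

lemma deriv_congr (k : Fin 2) {f g : M → V} (h : ∀ y ∈ U, f y = g y) {x : M} (hx : x ∈ U) :
    fr.deriv k f x = fr.deriv k g x :=
  dirDeriv_congr (eventually_of_mem (fr.isOpen.mem_nhds hx) h) _

lemma deriv_const (k : Fin 2) (c : V) (x : M) : fr.deriv k (fun _ => c) x = 0 :=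
  dirDeriv_const _ _ _

variable {x : M} (hx : x ∈ U)
include hx

lemma deriv_add (k : Fin 2) {f g : M → V} (hf : SmoothOn f U) (hg : SmoothOn g U) :
    fr.deriv k (fun y => f y + g y) x = fr.deriv k f x + fr.deriv k g x :=
  dirDeriv_add (hf.mdiff fr.isOpen hx) (hg.mdiff fr.isOpen hx) _

lemma deriv_sub (k : Fin 2) {f g : M → V} (hf : SmoothOn f U) (hg : SmoothOn g U) :
    fr.deriv k (fun y => f y - g y) x = fr.deriv k f x - fr.deriv k g x :=
  dirDeriv_sub (hf.mdiff fr.isOpen hx) (hg.mdiff fr.isOpen hx) _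

omit hx in
lemma deriv_neg (k : Fin 2) (f : M → V) :
    fr.deriv k (fun y => - f y) x = - fr.deriv k f x := dirDeriv_neg _

lemma deriv_smul (k : Fin 2) {a : M → ℝ} {f : M → V} (ha : SmoothOn a U) (hf : SmoothOn f U) :
    fr.deriv k (fun y => a y • f y) x = a x • fr.deriv k f x + fr.deriv k a x • f x :=
  dirDeriv_smul (ha.mdiff fr.isOpen hx) (hf.mdiff fr.isOpen hx) _

lemma deriv_mul (k : Fin 2) {a b : M → ℝ} (ha : SmoothOn a U) (hb : SmoothOn b U) :
    fr.deriv k (fun y => a y * b y) x = a x * fr.deriv k b x + fr.deriv k a x * b x :=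
  dirDeriv_mul (ha.mdiff fr.isOpen hx) (hb.mdiff fr.isOpen hx) _

lemma deriv_const_mul (k : Fin 2) (c : ℝ) {b : M → ℝ} (hb : SmoothOn b U) :
    fr.deriv k (fun y => c * b y) x = c * fr.deriv k b x :=
  dirDeriv_const_mul c (hb.mdiff fr.isOpen hx) _

lemma deriv_inner (k : Fin 2) {f g : M → H} (hf : SmoothOn f U) (hg : SmoothOn g U) :
    fr.deriv k (fun y => ⟪f y, g y⟫_ℝ) x = ⟪fr.deriv k f x, g x⟫_ℝ + ⟪f x, fr.deriv k g x⟫_ℝ :=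
  dirDeriv_inner (hf.mdiff fr.isOpen hx) (hg.mdiff fr.isOpen hx) _

/-- Differentiating the constancy of an inner product. -/
lemma deriv_inner_eq_zero (k : Fin 2) {f g : M → H} (hf : SmoothOn f U) (hg : SmoothOn g U)
    {c : ℝ} (h : ∀ y ∈ U, ⟪f y, g y⟫_ℝ = c) :
    ⟪fr.deriv k f x, g x⟫_ℝ + ⟪f x, fr.deriv k g x⟫_ℝ = 0 := by
  rw [← fr.deriv_inner hx k hf hg, fr.deriv_congr k h hx, deriv_const]

omit hx in
lemma deriv_position (k : Fin 2) : fr.deriv k (position F) = fr.vec k := rfl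

lemma inner_vec (i j : Fin 2) : ⟪fr.vec i x, fr.vec j x⟫_ℝ = if i = j then 1 else 0 :=
  orthonormal_iff_ite.1 (fr.orthonormal_e x hx) i j

lemma eq_sum_inner_vec (X : TangentSpace (𝓡 2) x) :
    X = ∑ i, ⟪dirDeriv (position F) x X, fr.vec i x⟫_ℝ • fr.e i x := by
  have hli : LinearIndependent ℝ (fun i => fr.e i x) := by
    have h := (fr.orthonormal_e x hx).linearIndependent
    exact LinearIndependent.of_comp (mfderiv (𝓡 2) 𝓘(ℝ, Ambient p) (position F) x).toLinearMap h
  have hd : Module.finrank ℝ (TangentSpace (𝓡 2) x) = 2 :=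
    finrank_euclideanSpace_fin (𝕜 := ℝ) (n := 2)
  have hspan := hli.span_eq_top_of_card_eq_finrank (by rw [hd]; simp)
  have hX : X ∈ Submodule.span ℝ (Set.range fun i => fr.e i x) := hspan ▸ Submodule.mem_top
  obtain ⟨c, rfl⟩ := (Submodule.mem_span_range_iff_exists_fun ℝ).1 hX
  have h1 : dirDeriv (position F) x (∑ i, c i • fr.e i x) = ∑ i, c i • fr.vec i x := by
    rw [Fin.sum_univ_two, Fin.sum_univ_two, dirDeriv_apply_add, dirDeriv_apply_smul,
      dirDeriv_apply_smul]; rfl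
  have h2 := fr.inner_vec hx
  refine Finset.sum_congr rfl fun i _ => ?_
  congr 1
  rw [h1, sum_inner]
  simp [real_inner_smul_left, h2]

lemma dirDeriv_eq_sum (f : M → V) (X : TangentSpace (𝓡 2) x) :
    dirDeriv f x X = ∑ i, ⟪dirDeriv (position F) x X, fr.vec i x⟫_ℝ • fr.deriv i f x := by
  conv_lhs => rw [fr.eq_sum_inner_vec hx X]
  rw [Fin.sum_univ_two, Fin.sum_univ_two, dirDeriv_apply_add, dirDeriv_apply_smul,
    dirDeriv_apply_smul]; rfl

lemma deriv_deriv_sub {f : M → V} (hf : SmoothOn f U) :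
    fr.deriv 0 (fr.deriv 1 f) x - fr.deriv 1 (fr.deriv 0 f) x =
      dirDeriv f x (mlieBracket (𝓡 2) (fr.e 0) (fr.e 1) x) := by
  symm
  refine dirDeriv_mlieBracket ((hf.contMDiffAt' fr.isOpen hx).of_le ENat.LEInfty.out) ?_ ?_
  · exact ((fr.smooth_e 0).contMDiffAt (fr.isOpen.mem_nhds hx)).mdifferentiableAt
      (by norm_num)
  · exact ((fr.smooth_e 1).contMDiffAt (fr.isOpen.mem_nhds hx)).mdifferentiableAt
      (by norm_num)

variable (hF : IsSmoothImmersion F)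
include hF

omit [IsManifold (𝓡 2) ∞ M] hx in
lemma smoothOn_position : SmoothOn (position F) U := hF.contMDiff_position.contMDiffOn

omit hx in
lemma smoothOn_vec (i : Fin 2) : SmoothOn (fr.vec i) U :=
  fr.smoothOn_deriv i (smoothOn_position hF)

lemma inner_position_vec (i : Fin 2) : ⟪position F x, fr.vec i x⟫_ℝ = 0 := by
  have := fr.deriv_inner_eq_zero hx i (smoothOn_position hF) (smoothOn_position hF)
    (fun y _ => inner_position_self y)
  rw [deriv_position, real_inner_comm] at this
  linarith

omit hx hF in
/-- The connection coefficient `ω₁₂(e_k)`. -/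
def w (k : Fin 2) (x : M) : ℝ := fr.conn 0 1 x (fr.e k x)

omit hx in
lemma smoothOn_w (k : Fin 2) : SmoothOn (fr.w k) U :=
  (fr.smoothOn_deriv k (fr.smoothOn_vec hF 0)).inner' (fr.smoothOn_vec hF 1)

lemma inner_deriv_vec_swap (i j k : Fin 2) :
    ⟪fr.deriv k (fr.vec i) x, fr.vec j x⟫_ℝ = - ⟪fr.deriv k (fr.vec j) x, fr.vec i x⟫_ℝ := by
  have := fr.deriv_inner_eq_zero hx k (fr.smoothOn_vec hF i) (fr.smoothOn_vec hF j)
    (fun y hy => fr.inner_vec hy i j)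
  rw [real_inner_comm (fr.deriv k (fr.vec j) x)] at this
  rw [real_inner_comm (fr.vec i x)]
  rw [real_inner_comm (fr.deriv k (fr.vec j) x)]
  linarith

lemma inner_deriv_vec_position (i k : Fin 2) :
    ⟪fr.deriv k (fr.vec i) x, position F x⟫_ℝ = - if i = k then 1 else 0 := by
  have := fr.deriv_inner_eq_zero hx k (smoothOn_position hF) (fr.smoothOn_vec hF i)
    (fun y hy => fr.inner_position_vec hy hF i)
  rw [deriv_position, fr.inner_vec hx, real_inner_comm] at this
  simp only [eq_comm (a := i)]
  linarith

lemma inner_deriv_vec (i j k : Fin 2) : ⟪fr.deriv k (fr.vec i) x, fr.vec j x⟫_ℝ =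
    if i = j then 0 else if i = 0 then fr.w k x else - fr.w k x := by
  have h := fr.inner_deriv_vec_swap hx hF i j k
  fin_cases i <;> fin_cases j <;> simp at h ⊢
  · linarith
  · rfl
  · rw [h]; rfl
  · linarith

/-- The coefficients of [e₁,e₂] in the frame are found by letting the bracket act on the position
vector: they are the tangential components of D_{e₁}e₂ - D_{e₂}e₁, i.e. the Levi-Civita connection
is torsion-free. -/
lemma dirDeriv_mlieBracket_frame (f : M → V) :
    dirDeriv f x (mlieBracket (𝓡 2) (fr.e 0) (fr.e 1) x) =
      - (fr.w 0 x • fr.deriv 0 f x + fr.w 1 x • fr.deriv 1 f x) := by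
  rw [fr.dirDeriv_eq_sum hx, ← fr.deriv_deriv_sub hx (smoothOn_position hF)]
  simp only [deriv_position, inner_sub_left, fr.inner_deriv_vec hx hF, Fin.sum_univ_two]
  simp
  module

/-- The commutator of the frame fields. -/
lemma deriv_comm {f : M → V} (hf : SmoothOn f U) :
    fr.deriv 0 (fr.deriv 1 f) x = fr.deriv 1 (fr.deriv 0 f) x
      - (fr.w 0 x • fr.deriv 0 f x + fr.w 1 x • fr.deriv 1 f x) := by
  have := fr.deriv_deriv_sub hx hf
  rw [fr.dirDeriv_mlieBracket_frame hx hF] at this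
  rw [sub_eq_iff_eq_add.1 this]; abel

lemma gaussCurvature_eq : fr.gaussCurvature x =
    -(fr.deriv 0 (fr.w 1) x - fr.deriv 1 (fr.w 0) x + fr.w 0 x ^ 2 + fr.w 1 x ^ 2) := by
  have h : fr.conn 0 1 x (mlieBracket (𝓡 2) (fr.e 0) (fr.e 1) x) = - (fr.w 0 x ^ 2 + fr.w 1 x ^ 2) := by
    rw [conn, fr.dirDeriv_mlieBracket_frame hx hF, inner_neg_left, inner_add_left, inner_smul_left,
      inner_smul_left, fr.inner_deriv_vec hx hF, fr.inner_deriv_vec hx hF]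
    simp; ring
  rw [gaussCurvature, h]
  change -(fr.deriv 0 (fr.w 1) x - fr.deriv 1 (fr.w 0) x - _) = _
  ring

end TangentFrame
end
end MinimalSurface

namespace MinimalSurface
noncomputable section

open Filter Topology VectorField

/-! ### Structure equations of a minimal surface: Gauss formula, Codazzi and Gauss equations. -/

section NormalSpace

variable {M : Type*} [TopologicalSpace M] [ChartedSpace (EuclideanSpace ℝ (Fin 2)) M]
  [IsManifold (𝓡 2) ∞ M] {p : ℕ} {F : M → UnitSphere p} {U : Set M}

omit [IsManifold (𝓡 2) ∞ M] in
lemma inner_position_of_mem_normalSpace {x : M} {n : Ambient p} (hn : n ∈ normalSpace F x) :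
    ⟪position F x, n⟫_ℝ = 0 :=
  (Submodule.mem_orthogonal _ _).1 hn _ (Submodule.subset_span (Or.inl rfl))

namespace TangentFrame

variable (fr : TangentFrame F U)

lemma inner_vec_of_mem_normalSpace {x : M} {n : Ambient p} (hn : n ∈ normalSpace F x) (i : Fin 2) :
    ⟪fr.vec i x, n⟫_ℝ = 0 :=
  (Submodule.mem_orthogonal _ _).1 hn _ (Submodule.subset_span (Or.inr ⟨_, rfl⟩))

variable {x : M} (hx : x ∈ U)
include hx

lemma mem_normalSpace {n : Ambient p} (h : ⟪position F x, n⟫_ℝ = 0)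
    (h' : ∀ i, ⟪fr.vec i x, n⟫_ℝ = 0) : n ∈ normalSpace F x := by
  refine (Submodule.mem_orthogonal _ _).2 fun u hu => ?_
  induction hu using Submodule.span_induction with
  | mem u hu =>
    rcases hu with rfl | ⟨X, rfl⟩
    · exact h
    · rw [fr.dirDeriv_eq_sum hx]
      simp [inner_add_left, real_inner_smul_left, deriv_position, h']
  | zero => simp
  | add u v _ _ hu hv => rw [inner_add_left, hu, hv, add_zero]
  | smul c u _ hu => rw [real_inner_smul_left, hu, mul_zero]

/-- The value `h(e₁, e₁)` of the second fundamental form, as a vector of `ℝ^{p+3}`. -/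
def A (fr : TangentFrame F U) (x : M) : Ambient p :=
  fr.deriv 0 (fr.vec 0) x - fr.w 0 x • fr.vec 1 x + position F x

/-- The value `h(e₁, e₂)` of the second fundamental form, as a vector of `ℝ^{p+3}`. -/
def B (fr : TangentFrame F U) (x : M) : Ambient p :=
  fr.deriv 1 (fr.vec 0) x - fr.w 1 x • fr.vec 1 x

variable (hF : IsSmoothImmersion F)
include hF

omit hx in
lemma smoothOn_A : SmoothOn fr.A U :=
  ((fr.smoothOn_deriv 0 (fr.smoothOn_vec hF 0)).sub'
    ((fr.smoothOn_w hF 0).smul' (fr.smoothOn_vec hF 1))).add' (smoothOn_position hF)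

omit hx in
lemma smoothOn_B : SmoothOn fr.B U :=
  (fr.smoothOn_deriv 1 (fr.smoothOn_vec hF 0)).sub'
    ((fr.smoothOn_w hF 1).smul' (fr.smoothOn_vec hF 1))

lemma A_mem_normalSpace : fr.A x ∈ normalSpace F x := by
  refine fr.mem_normalSpace hx ?_ fun i => ?_
  · rw [real_inner_comm, A, inner_add_left, inner_sub_left, real_inner_smul_left,
      fr.inner_deriv_vec_position hx hF, real_inner_comm, fr.inner_position_vec hx hF,
      inner_position_self]
    simp
  · rw [real_inner_comm, A, inner_add_left, inner_sub_left, real_inner_smul_left,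
      fr.inner_deriv_vec hx hF, fr.inner_vec hx, fr.inner_position_vec hx hF]
    fin_cases i <;> simp

lemma B_mem_normalSpace : fr.B x ∈ normalSpace F x := by
  refine fr.mem_normalSpace hx ?_ fun i => ?_
  · rw [real_inner_comm, B, inner_sub_left, real_inner_smul_left,
      fr.inner_deriv_vec_position hx hF, real_inner_comm, fr.inner_position_vec hx hF]
    simp
  · rw [real_inner_comm, B, inner_sub_left, real_inner_smul_left,
      fr.inner_deriv_vec hx hF, fr.inner_vec hx]
    fin_cases i <;> simp

omit hx hF in
lemma deriv_zero_vec_zero :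
    fr.deriv 0 (fr.vec 0) x = fr.w 0 x • fr.vec 1 x + fr.A x - position F x := by
  rw [A]; abel

omit hx hF in
lemma deriv_one_vec_zero : fr.deriv 1 (fr.vec 0) x = fr.w 1 x • fr.vec 1 x + fr.B x := by
  rw [B]; abel

/-- The commutator formula for the position vector; its normal part is the symmetry h(e₂,e₁) =
h(e₁,e₂). -/
lemma deriv_zero_vec_one : fr.deriv 0 (fr.vec 1) x = -fr.w 0 x • fr.vec 0 x + fr.B x := by
  have := fr.deriv_comm hx hF (smoothOn_position hF)
  simp only [deriv_position] at this
  change fr.deriv 0 (fr.vec 1) x = fr.deriv 1 (fr.vec 0) x - _ at this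
  rw [this, B]; module

lemma deriv_one_vec_one (hmin : IsMinimal F) :
    fr.deriv 1 (fr.vec 1) x = -fr.w 1 x • fr.vec 0 x - fr.A x - position F x := by
  -- `C` is h(e₂,e₂). Minimality makes the normal projection of D_{e₁}e₁ + D_{e₂}e₂ zero, so `A +
  -- C`, which is normal and differs from that sum by tangential and radial terms, is orthogonal to
  -- itself.
  set C := fr.deriv 1 (fr.vec 1) x + fr.w 1 x • fr.vec 0 x + position F x with hC
  have hCn : C ∈ normalSpace F x := by
    refine fr.mem_normalSpace hx ?_ fun i => ?_
    · rw [real_inner_comm, hC, inner_add_left, inner_add_left, real_inner_smul_left,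
        fr.inner_deriv_vec_position hx hF, real_inner_comm, fr.inner_position_vec hx hF,
        inner_position_self]
      simp
    · rw [real_inner_comm, hC, inner_add_left, inner_add_left, real_inner_smul_left,
        fr.inner_deriv_vec hx hF, fr.inner_vec hx, fr.inner_position_vec hx hF]
      fin_cases i <;> simp
  have hn : fr.A x + C ∈ normalSpace F x := add_mem (fr.A_mem_normalSpace hx hF) hCn
  have hm : (normalSpace F x).starProjection (fr.deriv 0 (fr.vec 0) x)
      + (normalSpace F x).starProjection (fr.deriv 1 (fr.vec 1) x) = 0 := by
    have := hmin U fr x hx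
    rw [meanCurvature, Fin.sum_univ_two, smul_eq_zero] at this
    exact this.resolve_left (by norm_num)
  rw [← map_add] at hm
  have h1 : ⟪fr.deriv 0 (fr.vec 0) x + fr.deriv 1 (fr.vec 1) x, fr.A x + C⟫_ℝ = 0 := by
    rw [← Submodule.starProjection_eq_self_iff.2 hn, ← Submodule.inner_starProjection_left_eq_right,
      hm, inner_zero_left]
  have h2 : fr.deriv 0 (fr.vec 0) x + fr.deriv 1 (fr.vec 1) x =
      (fr.A x + C) + (fr.w 0 x • fr.vec 1 x - fr.w 1 x • fr.vec 0 x - (2 : ℝ) • position F x) := by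
    rw [hC, A]; module
  rw [h2, inner_add_left, inner_sub_left, inner_sub_left, real_inner_smul_left,
    real_inner_smul_left, real_inner_smul_left, inner_position_of_mem_normalSpace hn,
    fr.inner_vec_of_mem_normalSpace hn, fr.inner_vec_of_mem_normalSpace hn] at h1
  have h3 : fr.A x + C = 0 := inner_self_eq_zero.1 (by linarith : ⟪fr.A x + C, fr.A x + C⟫_ℝ = 0)
  have h4 := eq_neg_of_add_eq_zero_left h3
  rw [h4, hC]; module

/-- The first Codazzi equation. -/
lemma codazzi_zero (hmin : IsMinimal F) : fr.deriv 0 fr.B x - fr.deriv 1 fr.A x =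
    -(2 * fr.w 0 x) • fr.A x - (2 * fr.w 1 x) • fr.B x + (fr.gaussCurvature x - 1) • fr.vec 1 x := by
  -- Flatness of ℝ^{p+3} applied to e₁. The derivatives of `A` and `B` are ambient ones, so they
  -- keep tangential parts; these account for the term with K - 1, from which the Gauss equation is
  -- read off later.
  have hc := fr.deriv_comm hx hF (fr.smoothOn_vec hF 0)
  have h1 := fr.deriv_congr 0 (f := fr.deriv 1 (fr.vec 0)) (fun y _ => fr.deriv_one_vec_zero) hx
  have h2 := fr.deriv_congr 1 (f := fr.deriv 0 (fr.vec 0)) (fun y _ => fr.deriv_zero_vec_zero) hx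
  rw [fr.deriv_add hx 0 ((fr.smoothOn_w hF 1).smul' (fr.smoothOn_vec hF 1)) (fr.smoothOn_B hF),
    fr.deriv_smul hx 0 (fr.smoothOn_w hF 1) (fr.smoothOn_vec hF 1),
    fr.deriv_zero_vec_one hx hF] at h1
  rw [fr.deriv_sub hx 1 (((fr.smoothOn_w hF 0).smul' (fr.smoothOn_vec hF 1)).add'
      (fr.smoothOn_A hF)) (smoothOn_position hF),
    fr.deriv_add hx 1 ((fr.smoothOn_w hF 0).smul' (fr.smoothOn_vec hF 1)) (fr.smoothOn_A hF),
    fr.deriv_smul hx 1 (fr.smoothOn_w hF 0) (fr.smoothOn_vec hF 1),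
    fr.deriv_one_vec_one hx hF hmin, deriv_position] at h2
  rw [h1, h2, fr.deriv_zero_vec_zero, fr.deriv_one_vec_zero] at hc
  rw [fr.gaussCurvature_eq hx hF, ← sub_eq_zero]
  rw [← sub_eq_zero] at hc
  rw [← hc]
  module

/-- The second Codazzi equation. -/
lemma codazzi_one (hmin : IsMinimal F) : fr.deriv 0 fr.A x + fr.deriv 1 fr.B x =
    (2 * fr.w 0 x) • fr.B x - (2 * fr.w 1 x) • fr.A x + (fr.gaussCurvature x - 1) • fr.vec 0 x := by
  have hc := fr.deriv_comm hx hF (fr.smoothOn_vec hF 1)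
  have h1 := fr.deriv_congr 0 (f := fr.deriv 1 (fr.vec 1))
    (fun y hy => fr.deriv_one_vec_one hy hF hmin) hx
  have h2 := fr.deriv_congr 1 (f := fr.deriv 0 (fr.vec 1))
    (fun y hy => fr.deriv_zero_vec_one hy hF) hx
  rw [fr.deriv_sub hx 0 (((fr.smoothOn_w hF 1).neg'.smul' (fr.smoothOn_vec hF 0)).sub'
      (fr.smoothOn_A hF)) (smoothOn_position hF),
    fr.deriv_sub hx 0 ((fr.smoothOn_w hF 1).neg'.smul' (fr.smoothOn_vec hF 0)) (fr.smoothOn_A hF),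
    fr.deriv_smul hx 0 (fr.smoothOn_w hF 1).neg' (fr.smoothOn_vec hF 0), fr.deriv_neg,
    fr.deriv_zero_vec_zero, deriv_position] at h1
  rw [fr.deriv_add hx 1 ((fr.smoothOn_w hF 0).neg'.smul' (fr.smoothOn_vec hF 0)) (fr.smoothOn_B hF),
    fr.deriv_smul hx 1 (fr.smoothOn_w hF 0).neg' (fr.smoothOn_vec hF 0), fr.deriv_neg,
    fr.deriv_one_vec_zero] at h2
  rw [h1, h2, fr.deriv_zero_vec_one hx hF, fr.deriv_one_vec_one hx hF hmin] at hc
  rw [fr.gaussCurvature_eq hx hF, ← sub_eq_zero]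
  rw [eq_comm, ← sub_eq_zero] at hc
  rw [← hc]
  module

/-- The Gauss equation. -/
lemma gauss (hmin : IsMinimal F) :
    fr.gaussCurvature x = 1 - ⟪fr.A x, fr.A x⟫_ℝ - ⟪fr.B x, fr.B x⟫_ℝ := by
  -- Component along e₂: since `A` and `B` are orthogonal to e₂, the derivative passes to e₂, giving
  -- ⟨D_{e₂}A, e₂⟩ = |A|² and ⟨D_{e₁}B, e₂⟩ = -|B|².
  have h := congrArg (fun z => ⟪z, fr.vec 1 x⟫_ℝ) (fr.codazzi_zero hx hF hmin)
  have hA := fr.deriv_inner_eq_zero hx 1 (fr.smoothOn_A hF) (fr.smoothOn_vec hF 1) (c := 0)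
    fun y hy => by
      rw [real_inner_comm, fr.inner_vec_of_mem_normalSpace (fr.A_mem_normalSpace hy hF)]
  have hB := fr.deriv_inner_eq_zero hx 0 (fr.smoothOn_B hF) (fr.smoothOn_vec hF 1) (c := 0)
    fun y hy => by
      rw [real_inner_comm, fr.inner_vec_of_mem_normalSpace (fr.B_mem_normalSpace hy hF)]
  rw [fr.deriv_one_vec_one hx hF hmin] at hA
  rw [fr.deriv_zero_vec_one hx hF] at hB
  have a0 := fr.inner_vec_of_mem_normalSpace (fr.A_mem_normalSpace hx hF) 0
  have a1 := fr.inner_vec_of_mem_normalSpace (fr.A_mem_normalSpace hx hF) 1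
  have a2 := inner_position_of_mem_normalSpace (fr.A_mem_normalSpace hx hF)
  have b0 := fr.inner_vec_of_mem_normalSpace (fr.B_mem_normalSpace hx hF) 0
  have b1 := fr.inner_vec_of_mem_normalSpace (fr.B_mem_normalSpace hx hF) 1
  rw [real_inner_comm] at a0 a1 a2 b0 b1
  simp only [inner_add_left, inner_sub_left, inner_add_right, inner_sub_right,
    real_inner_smul_left, real_inner_smul_right, a0, a1, a2, b0, b1, fr.inner_vec hx] at h hA hB
  simp at h
  linarith

end TangentFrame
end NormalSpace
end
end MinimalSurface

namespace MinimalSurface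
noncomputable section

open Filter Topology VectorField

/-! ### The quartic Hopf differential and its maximum principle. -/

section Quartic

variable {M : Type*} [TopologicalSpace M] [ChartedSpace (EuclideanSpace ℝ (Fin 2)) M]
  [IsManifold (𝓡 2) ∞ M] {p : ℕ} {F : M → UnitSphere p} {U : Set M}

namespace TangentFrame

variable (fr : TangentFrame F U)

/-- The real part of the coefficient of the quartic Hopf differential. -/
def hopfRe (x : M) : ℝ := ⟪fr.A x, fr.A x⟫_ℝ - ⟪fr.B x, fr.B x⟫_ℝ

/-- The imaginary part (up to sign) of the coefficient of the quartic Hopf differential. -/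
def hopfIm (x : M) : ℝ := 2 * ⟪fr.A x, fr.B x⟫_ℝ

/-- The squared length of the quartic Hopf differential. -/
def hopfSq (x : M) : ℝ := fr.hopfRe x ^ 2 + fr.hopfIm x ^ 2

variable {x : M} (hx : x ∈ U) (hF : IsSmoothImmersion F)
include hF

lemma smoothOn_hopfRe : SmoothOn fr.hopfRe U :=
  ((fr.smoothOn_A hF).inner' (fr.smoothOn_A hF)).sub' ((fr.smoothOn_B hF).inner' (fr.smoothOn_B hF))

lemma smoothOn_hopfIm : SmoothOn fr.hopfIm U :=
  (smoothOn_const 2).mul' ((fr.smoothOn_A hF).inner' (fr.smoothOn_B hF))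

lemma smoothOn_hopfSq : SmoothOn fr.hopfSq U := by
  have := ((fr.smoothOn_hopfRe hF).mul' (fr.smoothOn_hopfRe hF)).add'
    ((fr.smoothOn_hopfIm hF).mul' (fr.smoothOn_hopfIm hF))
  refine this.congr fun y _ => ?_
  simp only [hopfSq]; ring

include hx

lemma deriv_hopfRe (k : Fin 2) : fr.deriv k fr.hopfRe x =
    2 * ⟪fr.deriv k fr.A x, fr.A x⟫_ℝ - 2 * ⟪fr.deriv k fr.B x, fr.B x⟫_ℝ := by
  have h := fr.deriv_sub hx k ((fr.smoothOn_A hF).inner' (fr.smoothOn_A hF))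
    ((fr.smoothOn_B hF).inner' (fr.smoothOn_B hF))
  rw [fr.deriv_inner hx k (fr.smoothOn_A hF) (fr.smoothOn_A hF),
    fr.deriv_inner hx k (fr.smoothOn_B hF) (fr.smoothOn_B hF),
    real_inner_comm (fr.deriv k fr.A x), real_inner_comm (fr.deriv k fr.B x)] at h
  refine h.trans ?_
  rw [real_inner_comm (fr.A x), real_inner_comm (fr.B x)]
  ring

lemma deriv_hopfIm (k : Fin 2) : fr.deriv k fr.hopfIm x =
    2 * ⟪fr.deriv k fr.A x, fr.B x⟫_ℝ + 2 * ⟪fr.deriv k fr.B x, fr.A x⟫_ℝ := by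
  have h := fr.deriv_const_mul hx k 2 ((fr.smoothOn_A hF).inner' (fr.smoothOn_B hF))
  rw [fr.deriv_inner hx k (fr.smoothOn_A hF) (fr.smoothOn_B hF),
    ← real_inner_comm (fr.A x) (fr.deriv k fr.B x)] at h
  refine h.trans ?_
  ring

variable (hmin : IsMinimal F)
include hmin

/-- The first Cauchy-Riemann equation of the quartic Hopf differential. -/
lemma deriv_hopf_zero : fr.deriv 0 fr.hopfRe x + fr.deriv 1 fr.hopfIm x =
    4 * fr.w 0 x * fr.hopfIm x - 4 * fr.w 1 x * fr.hopfRe x := by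
  have hA := fr.A_mem_normalSpace hx hF
  have hB := fr.B_mem_normalSpace hx hF
  -- Pairing the Codazzi equations with the normal vectors `A` and `B` removes the tangential K - 1
  -- terms.
  have h1 := congrArg (fun z => ⟪z, fr.B x⟫_ℝ) (fr.codazzi_zero hx hF hmin)
  have h2 := congrArg (fun z => ⟪z, fr.A x⟫_ℝ) (fr.codazzi_one hx hF hmin)
  simp only [inner_add_left, inner_sub_left, real_inner_smul_left,
    fr.inner_vec_of_mem_normalSpace hA, fr.inner_vec_of_mem_normalSpace hB] at h1 h2
  rw [real_inner_comm (fr.A x) (fr.B x)] at h2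
  rw [fr.deriv_hopfRe hx hF, fr.deriv_hopfIm hx hF, hopfRe, hopfIm]
  linear_combination 2 * h2 - 2 * h1

/-- The second Cauchy-Riemann equation of the quartic Hopf differential. -/
lemma deriv_hopf_one : fr.deriv 0 fr.hopfIm x - fr.deriv 1 fr.hopfRe x =
    -4 * fr.w 0 x * fr.hopfRe x - 4 * fr.w 1 x * fr.hopfIm x := by
  have hA := fr.A_mem_normalSpace hx hF
  have hB := fr.B_mem_normalSpace hx hF
  have h1 := congrArg (fun z => ⟪z, fr.A x⟫_ℝ) (fr.codazzi_zero hx hF hmin)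
  have h2 := congrArg (fun z => ⟪z, fr.B x⟫_ℝ) (fr.codazzi_one hx hF hmin)
  simp only [inner_add_left, inner_sub_left, real_inner_smul_left,
    fr.inner_vec_of_mem_normalSpace hA, fr.inner_vec_of_mem_normalSpace hB] at h1 h2
  rw [real_inner_comm (fr.A x) (fr.B x)] at h1
  rw [fr.deriv_hopfRe hx hF, fr.deriv_hopfIm hx hF, hopfRe, hopfIm]
  linear_combination 2 * h1 + 2 * h2

/-- The maximum principle for the quartic Hopf differential. -/
lemma hopfSq_eq_zero_of_isLocalMax (hK : 0 < fr.gaussCurvature x) (hmax : IsLocalMax fr.hopfSq x) :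
    fr.hopfSq x = 0 := by
  by_contra hne
  set f := fr.hopfRe with hf
  set g := fr.hopfIm with hg
  have sf : SmoothOn f U := fr.smoothOn_hopfRe hF
  have sg : SmoothOn g U := fr.smoothOn_hopfIm hF
  have sw := fr.smoothOn_w hF
  -- `fc` and `gc` are the components of the covariant derivative of the form; the factor 4 is its
  -- degree, since the coefficient turns four times as fast as the frame. In these terms the
  -- Cauchy-Riemann equations have no connection terms.
  let fc : Fin 2 → M → ℝ := fun k y => fr.deriv k f y - 4 * (fr.w k y * g y)
  let gc : Fin 2 → M → ℝ := fun k y => fr.deriv k g y + 4 * (fr.w k y * f y)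
  have sfc : ∀ k, SmoothOn (fc k) U := fun k =>
    (fr.smoothOn_deriv k sf).sub' ((smoothOn_const 4).mul' ((sw k).mul' sg))
  have sgc : ∀ k, SmoothOn (gc k) U := fun k =>
    (fr.smoothOn_deriv k sg).add' ((smoothOn_const 4).mul' ((sw k).mul' sf))
  have cr0 : ∀ y ∈ U, fc 0 y = - gc 1 y := fun y hy => by
    simp only [fc, gc]; linear_combination fr.deriv_hopf_zero hy hF hmin
  have cr1 : ∀ y ∈ U, fc 1 y = gc 0 y := fun y hy => by
    simp only [fc, gc]; linear_combination - fr.deriv_hopf_one hy hF hmin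
  have hQ : ∀ k, ∀ y ∈ U, fr.deriv k fr.hopfSq y = 2 * (f y * fc k y + g y * gc k y) := by
    intro k y hy
    have h1 := fr.deriv_congr k (f := fr.hopfSq) (g := fun y => f y * f y + g y * g y)
      (fun y _ => by simp only [hopfSq, hf, hg]; ring) hy
    rw [fr.deriv_add hy k (sf.mul' sf) (sg.mul' sg), fr.deriv_mul hy k sf sf,
      fr.deriv_mul hy k sg sg] at h1
    rw [h1]; simp only [fc, gc]; ring
  have hQ2 : ContMDiffAt (𝓡 2) 𝓘(ℝ, ℝ) 2 fr.hopfSq x :=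
    ((fr.smoothOn_hopfSq hF).contMDiffAt' fr.isOpen hx).of_le ENat.LEInfty.out
  have hcrit : ∀ k, fr.deriv k fr.hopfSq x = 0 := fun k => dirDeriv_eq_zero_of_isLocalMax hQ2 hmax _
  have hn : f x ^ 2 + g x ^ 2 ≠ 0 := hne
  have c0 := hcrit 0
  have c1 := hcrit 1
  rw [hQ 0 x hx] at c0
  rw [hQ 1 x hx, cr1 x hx] at c1
  have cr0x := cr0 x hx
  have cr1x := cr1 x hx
  -- Criticality of the squared length together with Cauchy-Riemann is a homogeneous linear system
  -- for `fc 0 x` and `gc 0 x` with determinant f² + g², assumed nonzero.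
  have hf0 : fc 0 x = 0 := by
    have : (f x ^ 2 + g x ^ 2) * fc 0 x = 0 := by
      linear_combination (f x / 2) * c0 - (g x / 2) * c1 + g x ^ 2 * cr0x
    exact (mul_eq_zero.1 this).resolve_left hn
  have hg0 : gc 0 x = 0 := by
    have : (f x ^ 2 + g x ^ 2) * gc 0 x = 0 := by
      linear_combination (g x / 2) * c0 + (f x / 2) * c1 - f x * g x * cr0x
    exact (mul_eq_zero.1 this).resolve_left hn
  have hf1 : fc 1 x = 0 := by rw [cr1x, hg0]
  have hg1 : gc 1 x = 0 := by linarith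
  have hQQ : ∀ k, fr.deriv k (fr.deriv k fr.hopfSq) x ≤ 0 := fun k =>
    dirDeriv_dirDeriv_nonpos_of_isLocalMax hQ2
      (((fr.smooth_e k).contMDiffAt (fr.isOpen.mem_nhds hx)).mdifferentiableAt (by norm_num)) hmax
  have hQQ' : ∀ k, fr.deriv k (fr.deriv k fr.hopfSq) x =
      2 * (f x * fr.deriv k (fc k) x + fr.deriv k f x * fc k x
        + (g x * fr.deriv k (gc k) x + fr.deriv k g x * gc k x)) := fun k => by
    rw [fr.deriv_congr k (hQ k) hx, fr.deriv_const_mul hx k 2 ((sf.mul' (sfc k)).add'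
      (sg.mul' (sgc k))), fr.deriv_add hx k (sf.mul' (sfc k)) (sg.mul' (sgc k)),
      fr.deriv_mul hx k sf (sfc k), fr.deriv_mul hx k sg (sgc k)]
  have dfc : ∀ k j, fr.deriv k (fc j) x = fr.deriv k (fr.deriv j f) x
      - 4 * (fr.w j x * fr.deriv k g x + fr.deriv k (fr.w j) x * g x) := fun k j => by
    rw [fr.deriv_sub hx k (fr.smoothOn_deriv j sf) ((smoothOn_const 4).mul' ((sw j).mul' sg)),
      fr.deriv_const_mul hx k 4 ((sw j).mul' sg), fr.deriv_mul hx k (sw j) sg]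
  have dgc : ∀ k j, fr.deriv k (gc j) x = fr.deriv k (fr.deriv j g) x
      + 4 * (fr.w j x * fr.deriv k f x + fr.deriv k (fr.w j) x * f x) := fun k j => by
    rw [fr.deriv_add hx k (fr.smoothOn_deriv j sg) ((smoothOn_const 4).mul' ((sw j).mul' sf)),
      fr.deriv_const_mul hx k 4 ((sw j).mul' sf), fr.deriv_mul hx k (sw j) sf]
  -- Cauchy-Riemann turns the pure second derivatives into mixed ones, so that their sum is a
  -- commutator and only curvature remains.
  have e0 : fr.deriv 0 (fc 0) x = - fr.deriv 0 (gc 1) x := by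
    rw [fr.deriv_congr 0 cr0 hx, fr.deriv_neg]
  have e1 : fr.deriv 1 (fc 1) x = fr.deriv 1 (gc 0) x := fr.deriv_congr 1 cr1 hx
  have e2 : fr.deriv 0 (gc 0) x = fr.deriv 0 (fc 1) x := (fr.deriv_congr 0 cr1 hx).symm
  have e3 : fr.deriv 1 (gc 1) x = - fr.deriv 1 (fc 0) x := by
    rw [fr.deriv_congr 1 cr0 hx, fr.deriv_neg, neg_neg]
  have q0 := hQQ 0
  have q1 := hQQ 1
  rw [hQQ', e0, e2, dgc, dfc, hf0, hg0, fr.deriv_comm hx hF sf, fr.deriv_comm hx hF sg] at q0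
  rw [hQQ', e1, e3, dgc, dfc, hf1, hg1] at q1
  have k0 : fr.deriv 0 f x = 4 * (fr.w 0 x * g x) := by simpa [fc, sub_eq_zero] using hf0
  have k1 : fr.deriv 1 f x = 4 * (fr.w 1 x * g x) := by simpa [fc, sub_eq_zero] using hf1
  have k2 : fr.deriv 0 g x = - 4 * (fr.w 0 x * f x) := by simp only [gc] at hg0; linarith
  have k3 : fr.deriv 1 g x = - 4 * (fr.w 1 x * f x) := by simp only [gc] at hg1; linarith
  simp only [smul_eq_mul, k0, k1, k2, k3] at q0 q1
  have hKe := fr.gaussCurvature_eq hx hF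
  have hpos : 0 < f x ^ 2 + g x ^ 2 := lt_of_le_of_ne (by positivity) hn.symm
  -- This quantity is the sum of the two second derivatives bounded above by 0 in `q0` and `q1`.
  have : 0 < 8 * fr.gaussCurvature x * (f x ^ 2 + g x ^ 2) := by positivity
  rw [hKe] at this
  linarith

end TangentFrame
end Quartic
end
end MinimalSurface

namespace MinimalSurface
noncomputable section

open Filter Topology VectorField

/-! ### Frame independence, existence of frames, and vanishing of the Hopf differential. -/

section Global

variable {M : Type*} [TopologicalSpace M] [ChartedSpace (EuclideanSpace ℝ (Fin 2)) M]
  [IsManifold (𝓡 2) ∞ M] {p : ℕ} {F : M → UnitSphere p} {U U' : Set M}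

omit [IsManifold (𝓡 2) ∞ M] in
lemma inner_dirDeriv_position_of_mem_normalSpace {x : M} {n : Ambient p}
    (hn : n ∈ normalSpace F x) (X : TangentSpace (𝓡 2) x) :
    ⟪dirDeriv (position F) x X, n⟫_ℝ = 0 :=
  (Submodule.mem_orthogonal _ _).1 hn _ (Submodule.subset_span (Or.inr ⟨_, rfl⟩))

omit [IsManifold (𝓡 2) ∞ M] in
lemma eq_of_forall_inner_normalSpace {x : M} {m n : Ambient p} (hm : m ∈ normalSpace F x)
    (hn : n ∈ normalSpace F x) (h : ∀ u ∈ normalSpace F x, ⟪m, u⟫_ℝ = ⟪n, u⟫_ℝ) : m = n := by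
  have h1 := h _ (sub_mem hm hn)
  rw [← sub_eq_zero, ← inner_sub_left, inner_self_eq_zero, sub_eq_zero] at h1
  exact h1

namespace TangentFrame

variable (fr : TangentFrame F U) (fr' : TangentFrame F U')
variable {x : M} (hx : x ∈ U) (hx' : x ∈ U') (hF : IsSmoothImmersion F) (hmin : IsMinimal F)
include hx hF

/-- The second fundamental form is symmetric, even for fields from different frames. -/
lemma inner_dirDeriv_vec_comm (hx' : x ∈ U') (i l : Fin 2) {n : Ambient p}
    (hn : n ∈ normalSpace F x) :
    ⟪dirDeriv (fr'.vec i) x (fr.e l x), n⟫_ℝ = ⟪dirDeriv (fr.vec l) x (fr'.e i x), n⟫_ℝ := by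
  have h := dirDeriv_mlieBracket ((hF.contMDiff_position x).of_le ENat.LEInfty.out)
    (((fr.smooth_e l).contMDiffAt (fr.isOpen.mem_nhds hx)).mdifferentiableAt (by norm_num))
    (((fr'.smooth_e i).contMDiffAt (fr'.isOpen.mem_nhds hx')).mdifferentiableAt (by norm_num))
  have h1 := inner_dirDeriv_position_of_mem_normalSpace hn
    (mlieBracket (𝓡 2) (fr.e l) (fr'.e i) x)
  rw [h, inner_sub_left, sub_eq_zero] at h1
  exact h1

include hx'

/-- Tensoriality of the second fundamental form. The direction of differentiation expands linearly;
symmetry then exchanges it with the differentiated field, which expands the same way. -/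
lemma dirDeriv_vec_eq_sum (i j : Fin 2) {n : Ambient p} (hn : n ∈ normalSpace F x) :
    ⟪fr'.deriv j (fr'.vec i) x, n⟫_ℝ =
      ∑ l, ∑ m, ⟪fr'.vec j x, fr.vec l x⟫_ℝ * ⟪fr'.vec i x, fr.vec m x⟫_ℝ *
        ⟪fr.deriv m (fr.vec l) x, n⟫_ℝ := by
  have h1 : fr'.deriv j (fr'.vec i) x =
      ∑ l, ⟪fr'.vec j x, fr.vec l x⟫_ℝ • fr.deriv l (fr'.vec i) x :=
    fr.dirDeriv_eq_sum hx (fr'.vec i) (fr'.e j x)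
  rw [h1, sum_inner]
  refine Finset.sum_congr rfl fun l _ => ?_
  have h2 : ⟪fr.deriv l (fr'.vec i) x, n⟫_ℝ = ⟪dirDeriv (fr.vec l) x (fr'.e i x), n⟫_ℝ :=
    fr.inner_dirDeriv_vec_comm fr' hx hF hx' i l hn
  have h3 : dirDeriv (fr.vec l) x (fr'.e i x) =
      ∑ m, ⟪fr'.vec i x, fr.vec m x⟫_ℝ • fr.deriv m (fr.vec l) x :=
    fr.dirDeriv_eq_sum hx (fr.vec l) (fr'.e i x)
  rw [real_inner_smul_left, h2, h3, sum_inner, Finset.mul_sum]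
  refine Finset.sum_congr rfl fun m _ => ?_
  rw [real_inner_smul_left]; ring

omit hF in
lemma inner_vec_vec (i j : Fin 2) :
    ∑ l, ⟪fr'.vec i x, fr.vec l x⟫_ℝ * ⟪fr'.vec j x, fr.vec l x⟫_ℝ = if i = j then 1 else 0 := by
  rw [← fr'.inner_vec hx']
  have h1 : fr'.vec i x = ∑ l, ⟪fr'.vec i x, fr.vec l x⟫_ℝ • fr.vec l x :=
    fr.dirDeriv_eq_sum hx (position F) (fr'.e i x)
  conv_rhs => rw [h1, sum_inner]
  refine Finset.sum_congr rfl fun l _ => ?_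
  rw [real_inner_smul_left, real_inner_comm (fr.vec l x) (fr'.vec j x)]

include hmin

/-- Two frames differ by an element of O(2). A rotation by θ turns the pair `A`, `B` by 2θ and the
Hopf coefficient by 4θ; a reflection also conjugates it. Its modulus is unchanged. -/
lemma hopfSq_eq : fr'.hopfSq x = fr.hopfSq x := by
  set a := ⟪fr'.vec 0 x, fr.vec 0 x⟫_ℝ with ha
  set b := ⟪fr'.vec 0 x, fr.vec 1 x⟫_ℝ with hb
  set c := ⟪fr'.vec 1 x, fr.vec 0 x⟫_ℝ with hc
  set d := ⟪fr'.vec 1 x, fr.vec 1 x⟫_ℝ with hd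
  have r00 := fr.inner_vec_vec fr' hx hx' 0 0
  have r01 := fr.inner_vec_vec fr' hx hx' 0 1
  have r11 := fr.inner_vec_vec fr' hx hx' 1 1
  simp only [Fin.sum_univ_two, ← ha, ← hb, ← hc, ← hd] at r00 r01 r11
  norm_num at r00 r01 r11
  have nA := fr.A_mem_normalSpace hx hF
  have nB := fr.B_mem_normalSpace hx hF
  have key : ∀ i j : Fin 2, ∀ n ∈ normalSpace F x, ⟪fr'.deriv j (fr'.vec i) x, n⟫_ℝ =
      (⟪fr'.vec j x, fr.vec 0 x⟫_ℝ * ⟪fr'.vec i x, fr.vec 0 x⟫_ℝ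
        - ⟪fr'.vec j x, fr.vec 1 x⟫_ℝ * ⟪fr'.vec i x, fr.vec 1 x⟫_ℝ) * ⟪fr.A x, n⟫_ℝ +
      (⟪fr'.vec j x, fr.vec 0 x⟫_ℝ * ⟪fr'.vec i x, fr.vec 1 x⟫_ℝ
        + ⟪fr'.vec j x, fr.vec 1 x⟫_ℝ * ⟪fr'.vec i x, fr.vec 0 x⟫_ℝ) * ⟪fr.B x, n⟫_ℝ := by
    intro i j n hn
    rw [fr.dirDeriv_vec_eq_sum fr' hx hx' hF i j hn]
    simp only [Fin.sum_univ_two, fr.deriv_zero_vec_zero, fr.deriv_one_vec_zero,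
      fr.deriv_zero_vec_one hx hF, fr.deriv_one_vec_one hx hF hmin, inner_add_left, inner_sub_left,
      real_inner_smul_left, fr.inner_vec_of_mem_normalSpace hn,
      inner_position_of_mem_normalSpace hn]
    ring
  have hA : fr'.A x = (a ^ 2 - b ^ 2) • fr.A x + (2 * a * b) • fr.B x := by
    refine eq_of_forall_inner_normalSpace (fr'.A_mem_normalSpace hx' hF)
      (add_mem (Submodule.smul_mem _ _ nA) (Submodule.smul_mem _ _ nB)) fun n hn => ?_
    rw [A, inner_add_left, inner_sub_left, key 0 0 n hn, inner_add_left]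
    simp only [real_inner_smul_left, fr'.inner_vec_of_mem_normalSpace hn,
      inner_position_of_mem_normalSpace hn]
    ring
  have hB : fr'.B x = (a * c - b * d) • fr.A x + (a * d + b * c) • fr.B x := by
    refine eq_of_forall_inner_normalSpace (fr'.B_mem_normalSpace hx' hF)
      (add_mem (Submodule.smul_mem _ _ nA) (Submodule.smul_mem _ _ nB)) fun n hn => ?_
    rw [B, inner_sub_left, key 0 1 n hn, inner_add_left]
    simp only [real_inner_smul_left, fr'.inner_vec_of_mem_normalSpace hn]
    ring
  -- The determinant `s` of the transition matrix is ±1 and covers both orientations. The quantities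
  -- a² - b² and 2ab are the cosine and sine of 2θ; afterwards only the sum of their squares
  -- matters.
  set s := a * d - b * c with hs
  have ec : c = - s * b := by rw [hs]; linear_combination (-c) * r00 + a * r01
  have ed : d = s * a := by rw [hs]; linear_combination (-d) * r00 + b * r01
  have hs2 : s ^ 2 = 1 := by
    have : (s * b) * (s * b) + (s * a) * (s * a) = 1 := by rw [← r11, ec, ed]; ring
    linear_combination this - s ^ 2 * r00
  have e1 : a * c - b * d = - s * (2 * a * b) := by rw [ec, ed]; ring
  have e2 : a * d + b * c = s * (a ^ 2 - b ^ 2) := by rw [ec, ed]; ring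
  have hpq : (a ^ 2 - b ^ 2) ^ 2 + (2 * a * b) ^ 2 = 1 := by
    linear_combination (a ^ 2 + b ^ 2 + 1) * r00
  rw [e1, e2] at hB
  clear_value s
  generalize a ^ 2 - b ^ 2 = P at *
  generalize 2 * a * b = R at *
  have e : ⟪fr.A x, fr.B x⟫_ℝ = ⟪fr.B x, fr.A x⟫_ℝ := real_inner_comm _ _
  have hf : fr'.hopfRe x = (P ^ 2 - R ^ 2) * fr.hopfRe x + 2 * P * R * fr.hopfIm x := by
    simp only [hopfRe, hopfIm, hA, hB, inner_add_left, inner_add_right,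
      real_inner_smul_left, real_inner_smul_right, e]
    linear_combination (-(R ^ 2 * ⟪fr.A x, fr.A x⟫_ℝ - 2 * P * R * ⟪fr.B x, fr.A x⟫_ℝ
      + P ^ 2 * ⟪fr.B x, fr.B x⟫_ℝ)) * hs2
  have hg : fr'.hopfIm x = s * ((P ^ 2 - R ^ 2) * fr.hopfIm x - 2 * P * R * fr.hopfRe x) := by
    simp only [hopfRe, hopfIm, hA, hB, inner_add_left, inner_add_right,
      real_inner_smul_left, real_inner_smul_right, e]
    ring
  rw [hopfSq, hopfSq, hf, hg]
  linear_combination ((P ^ 2 - R ^ 2) * fr.hopfIm x - 2 * P * R * fr.hopfRe x) ^ 2 * hs2 +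
    (P ^ 2 + R ^ 2 + 1) * (fr.hopfRe x ^ 2 + fr.hopfIm x ^ 2) * hpq

end TangentFrame

lemma inner_inv_norm_smul_self {H : Type*} [NormedAddCommGroup H] [InnerProductSpace ℝ H] {v : H}
    (hv : v ≠ 0) : ⟪‖v‖⁻¹ • v, ‖v‖⁻¹ • v⟫_ℝ = 1 := by
  rw [real_inner_self_eq_norm_sq, norm_smul, norm_inv, norm_norm,
    inv_mul_cancel₀ (norm_ne_zero_iff.2 hv), one_pow]

omit [IsManifold (𝓡 2) ∞ M] in
lemma smoothOn_inv_norm {H : Type*} [NormedAddCommGroup H] [InnerProductSpace ℝ H] {f : M → H}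
    (hf : SmoothOn f U) (h0 : ∀ x ∈ U, f x ≠ 0) : SmoothOn (fun x => ‖f x‖⁻¹) U := by
  intro x hx
  have h1 : ContDiffAt ℝ ∞ (fun v : H => ‖v‖⁻¹) (f x) :=
    (contDiffAt_norm ℝ (h0 x hx)).inv (norm_ne_zero_iff.2 (h0 x hx))
  exact h1.contMDiffAt.comp_contMDiffWithinAt x (hf x hx)

/-- Local orthonormal tangent frames exist. -/
lemma exists_tangentFrame (hF : IsSmoothImmersion F) (x : M) :
    ∃ U, x ∈ U ∧ Nonempty (TangentFrame F U) := by
  let t := trivializationAt (EuclideanSpace ℝ (Fin 2)) (TangentSpace (𝓡 2) : M → Type _) x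
  let b := (EuclideanSpace.basisFun (Fin 2) ℝ).toBasis
  have hlf := t.isLocalFrameOn_localFrame_baseSet (𝓡 2) ∞ b
  set s := t.localFrame b with hs
  have hV : ∀ i, SmoothOn (fun y => dirDeriv (position F) y (s i y)) t.baseSet := fun i =>
    contMDiffOn_dirDeriv t.open_baseSet (TangentFrame.smoothOn_position hF) (hlf.contMDiffOn i)
  have hinj := hF.dirDeriv_position_injective
  have hne0 : ∀ y ∈ t.baseSet, dirDeriv (position F) y (s 0 y) ≠ 0 := by
    intro y hy h
    rw [← dirDeriv_apply_zero (position F) y] at h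
    exact (hlf.linearIndependent hy).ne_zero 0 (hinj y h)
  -- Gram-Schmidt for the induced metric, applied to a local frame coming from a trivialization of
  -- the tangent bundle.
  let e0 : (y : M) → TangentSpace (𝓡 2) y :=
    fun y => ‖dirDeriv (position F) y (s 0 y)‖⁻¹ • s 0 y
  have se0 : ContMDiffOn (𝓡 2) ((𝓡 2).prod 𝓘(ℝ, EuclideanSpace ℝ (Fin 2))) ∞
      (fun x => (⟨x, e0 x⟩ : TangentBundle (𝓡 2) M)) t.baseSet :=
    ContMDiffOn.smul_section (smoothOn_inv_norm (hV 0) hne0) (hlf.contMDiffOn 0)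
  have sv0 := contMDiffOn_dirDeriv t.open_baseSet (TangentFrame.smoothOn_position hF) se0
  let r : M → ℝ := fun y => ⟪dirDeriv (position F) y (e0 y), dirDeriv (position F) y (s 1 y)⟫_ℝ
  have sr : SmoothOn r t.baseSet := SmoothOn.inner' sv0 (hV 1)
  let q : (y : M) → TangentSpace (𝓡 2) y := fun y => s 1 y - r y • e0 y
  have sq : ContMDiffOn (𝓡 2) ((𝓡 2).prod 𝓘(ℝ, EuclideanSpace ℝ (Fin 2))) ∞
      (fun x => (⟨x, q x⟩ : TangentBundle (𝓡 2) M)) t.baseSet :=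
    ContMDiffOn.sub_section (hlf.contMDiffOn 1) (ContMDiffOn.smul_section sr se0)
  have svq := contMDiffOn_dirDeriv t.open_baseSet (TangentFrame.smoothOn_position hF) sq
  have hneq : ∀ y ∈ t.baseSet, dirDeriv (position F) y (q y) ≠ 0 := by
    intro y hy h
    rw [← dirDeriv_apply_zero (position F) y] at h
    have h1 : s 1 y - r y • (‖dirDeriv (position F) y (s 0 y)‖⁻¹ • s 0 y) = 0 := hinj y h
    have h2 := Fintype.linearIndependent_iff.1 (hlf.linearIndependent hy)
      ![-(r y * ‖dirDeriv (position F) y (s 0 y)‖⁻¹), 1]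
      (by rw [← h1]; simp [mul_smul]; abel) 1
    simp at h2
  let e1 : (y : M) → TangentSpace (𝓡 2) y := fun y => ‖dirDeriv (position F) y (q y)‖⁻¹ • q y
  have se1 : ContMDiffOn (𝓡 2) ((𝓡 2).prod 𝓘(ℝ, EuclideanSpace ℝ (Fin 2))) ∞
      (fun x => (⟨x, e1 x⟩ : TangentBundle (𝓡 2) M)) t.baseSet :=
    ContMDiffOn.smul_section (smoothOn_inv_norm svq hneq) sq
  have hunit : ∀ y ∈ t.baseSet,
      ⟪dirDeriv (position F) y (e0 y), dirDeriv (position F) y (e0 y)⟫_ℝ = 1 := by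
    intro y hy
    simp only [e0, dirDeriv_apply_smul]
    exact inner_inv_norm_smul_self (hne0 y hy)
  refine ⟨t.baseSet, FiberBundle.mem_baseSet_trivializationAt' x, ⟨⟨t.open_baseSet,
    fun i => if i = 0 then e0 else e1, fun i => ?_, fun y hy => ?_⟩⟩⟩
  · fin_cases i
    · exact se0
    · exact se1
  · have h01 : ⟪dirDeriv (position F) y (e0 y), dirDeriv (position F) y (e1 y)⟫_ℝ = 0 := by
      have : dirDeriv (position F) y (q y) =
          dirDeriv (position F) y (s 1 y) - r y • dirDeriv (position F) y (e0 y) := by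
        rw [← dirDeriv_apply_smul]; exact map_sub _ _ _
      simp only [e1, dirDeriv_apply_smul, real_inner_smul_right, this, inner_sub_right, hunit y hy]
      simp [r]
    have h11 : ⟪dirDeriv (position F) y (e1 y), dirDeriv (position F) y (e1 y)⟫_ℝ = 1 := by
      simp only [e1, dirDeriv_apply_smul]
      exact inner_inv_norm_smul_self (hneq y hy)
    rw [orthonormal_iff_ite]
    intro i j
    fin_cases i <;> fin_cases j
    · exact hunit y hy
    · exact h01
    · exact (real_inner_comm _ _).trans h01
    · exact h11

/-- Minimal surfaces with positive curvature are superminimal: the quartic Hopf differential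
vanishes. -/
theorem TangentFrame.hopfSq_eq_zero [CompactSpace M] (hF : IsSmoothImmersion F)
    (hmin : IsMinimal F) (hK : HasPositiveGaussCurvature F) (fr : TangentFrame F U)
    {x : M} (hx : x ∈ U) : fr.hopfSq x = 0 := by
  choose W hW fW using exists_tangentFrame hF
  let f := fun y => (fW y).some
  -- The local squared lengths, one chosen frame per point, glue by frame independence to a
  -- continuous function, which attains its maximum on the compact M. That maximum is 0.
  let Q : M → ℝ := fun y => (f y).hopfSq y
  have hQ : ∀ {V : Set M} (g : TangentFrame F V) (y : M), y ∈ V → Q y = g.hopfSq y :=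
    fun g y hy => g.hopfSq_eq (f y) hy (hW y) hF hmin
  have hloc : ∀ y, Q =ᶠ[𝓝 y] (f y).hopfSq := fun y =>
    eventually_of_mem ((f y).isOpen.mem_nhds (hW y)) (hQ (f y))
  have hcont : Continuous Q := continuous_iff_continuousAt.2 fun y =>
    (((f y).smoothOn_hopfSq hF).contMDiffAt' (f y).isOpen (hW y)).continuousAt.congr
      (hloc y).symm
  obtain ⟨z, -, hz⟩ := isCompact_univ.exists_isMaxOn ⟨x, mem_univ x⟩ hcont.continuousOn
  have hmax : IsLocalMax (f z).hopfSq z := by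
    filter_upwards [hloc z] with y hy
    rw [← hy]
    exact hz (mem_univ y)
  have hz0 := (f z).hopfSq_eq_zero_of_isLocalMax (hW z) hF hmin (hK _ (f z) z (hW z)) hmax
  have h1 : Q x ≤ Q z := hz (mem_univ x)
  rw [hQ fr x hx] at h1
  have h2 : 0 ≤ fr.hopfSq x := by unfold TangentFrame.hopfSq; positivity
  have h3 : Q z = 0 := hz0
  linarith

end Global
end
end MinimalSurface

namespace MinimalSurface
noncomputable section

open Filter Topology VectorField

/-! ### The normal connection in components and its curvature. -/

namespace AdaptedFrame

variable {M : Type*} [TopologicalSpace M] [ChartedSpace (EuclideanSpace ℝ (Fin 2)) M]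
  [IsManifold (𝓡 2) ∞ M] {p : ℕ} {F : M → UnitSphere p} {U : Set M} (fr : AdaptedFrame F U)
variable {x : M} (hx : x ∈ U) (hF : IsSmoothImmersion F)

lemma D_eq (k : Fin 2) (f : M → ℝ) : fr.D k f = fr.toTangentFrame.deriv k f := rfl

include hx hF in
-- Dimension count: the position vector and e₁, e₂ take three of the p + 3 dimensions, so the p
-- orthonormal normal fields fill the rest.
lemma span_ν : Submodule.span ℝ (Set.range fun α => fr.ν α x) = normalSpace F x := by
  have hle : Submodule.span ℝ (Set.range fun α => fr.ν α x) ≤ normalSpace F x := by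
    rw [Submodule.span_le]
    rintro _ ⟨α, rfl⟩
    exact fr.normal_ν x hx α
  refine Submodule.eq_of_le_of_finrank_le hle ?_
  rw [finrank_span_eq_card (fr.orthonormal_ν x hx).linearIndependent, Fintype.card_fin]
  have ho : Orthonormal ℝ ![position F x, fr.vec 0 x, fr.vec 1 x] := by
    have h0 := fr.inner_position_vec hx hF 0
    have h1 := fr.inner_position_vec hx hF 1
    have h2 := fr.inner_vec hx
    rw [orthonormal_iff_ite]
    intro i j
    fin_cases i <;> fin_cases j
    · exact inner_position_self x
    · exact h0
    · exact h1
    · exact (real_inner_comm _ _).trans h0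
    · exact h2 0 0
    · exact h2 0 1
    · exact (real_inner_comm _ _).trans h1
    · exact h2 1 0
    · exact h2 1 1
  have hspan : Submodule.span ℝ (Set.range ![position F x, fr.vec 0 x, fr.vec 1 x])
      ≤ (normalSpace F x)ᗮ := by
    rw [Submodule.span_le]
    rintro _ ⟨i, rfl⟩
    refine (Submodule.mem_orthogonal' _ _).2 fun n hn => ?_
    fin_cases i
    · exact inner_position_of_mem_normalSpace hn
    · exact fr.inner_vec_of_mem_normalSpace hn 0
    · exact fr.inner_vec_of_mem_normalSpace hn 1
  have h3 := Submodule.finrank_mono hspan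
  rw [finrank_span_eq_card ho.linearIndependent, Fintype.card_fin] at h3
  have h4 := (normalSpace F x).finrank_add_finrank_orthogonal
  rw [finrank_euclideanSpace_fin] at h4
  omega

include hx hF in
/-- Parseval's identity in the normal space. -/
lemma sum_inner_ν_mul {m : Ambient p} (hm : m ∈ normalSpace F x) (n : Ambient p) :
    ∑ α, ⟪m, fr.ν α x⟫_ℝ * ⟪fr.ν α x, n⟫_ℝ = ⟪m, n⟫_ℝ := by
  rw [← fr.span_ν hx hF] at hm
  obtain ⟨c, rfl⟩ := (Submodule.mem_span_range_iff_exists_fun ℝ).1 hm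
  have ho := fr.orthonormal_ν x hx
  rw [sum_inner]
  refine Finset.sum_congr rfl fun α _ => ?_
  rw [real_inner_smul_left, real_inner_comm, ho.inner_right_fintype]

include hx in
lemma inner_vec_ν (i : Fin 2) (α : Fin p) : ⟪fr.vec i x, fr.ν α x⟫_ℝ = 0 :=
  fr.inner_vec_of_mem_normalSpace (fr.normal_ν x hx α) i

/-- The covariant derivative in the direction `e_k` of a section of the normal bundle, in
components. -/
def normD (k : Fin 2) (f : Fin p → M → ℝ) (α : Fin p) (x : M) : ℝ :=
  fr.D k (f α) x + ∑ β, f β x * fr.connN β α k x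

include hx in
lemma normD_congr (k : Fin 2) {f g : Fin p → M → ℝ} (h : ∀ α, ∀ y ∈ U, f α y = g α y)
    (α : Fin p) : fr.normD k f α x = fr.normD k g α x := by
  rw [normD, normD, D_eq, D_eq, fr.toTangentFrame.deriv_congr k (h α) hx]
  simp only [h _ x hx]

include hx in
lemma normD_add (k : Fin 2) {f g : Fin p → M → ℝ} (hf : ∀ α, SmoothOn (f α) U)
    (hg : ∀ α, SmoothOn (g α) U) (α : Fin p) :
    fr.normD k (fun β y => f β y + g β y) α x = fr.normD k f α x + fr.normD k g α x := by
  simp only [normD, D_eq]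
  rw [fr.toTangentFrame.deriv_add hx k (hf α) (hg α)]
  simp only [add_mul, Finset.sum_add_distrib]; ring

include hx in
lemma normD_sub (k : Fin 2) {f g : Fin p → M → ℝ} (hf : ∀ α, SmoothOn (f α) U)
    (hg : ∀ α, SmoothOn (g α) U) (α : Fin p) :
    fr.normD k (fun β y => f β y - g β y) α x = fr.normD k f α x - fr.normD k g α x := by
  simp only [normD, D_eq]
  rw [fr.toTangentFrame.deriv_sub hx k (hf α) (hg α)]
  simp only [sub_mul, Finset.sum_sub_distrib]; ring

lemma normD_neg (k : Fin 2) (f : Fin p → M → ℝ) (α : Fin p) :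
    fr.normD k (fun β y => - f β y) α x = - fr.normD k f α x := by
  simp only [normD, D_eq]
  rw [fr.toTangentFrame.deriv_neg k (f α)]
  simp only [neg_mul, Finset.sum_neg_distrib]; ring

include hx in
lemma normD_mul (k : Fin 2) {c : M → ℝ} {f : Fin p → M → ℝ} (hc : SmoothOn c U)
    (hf : ∀ α, SmoothOn (f α) U) (α : Fin p) :
    fr.normD k (fun β y => c y * f β y) α x =
      c x * fr.normD k f α x + fr.D k c x * f α x := by
  simp only [normD, D_eq]
  rw [fr.toTangentFrame.deriv_mul hx k hc (hf α), mul_add, Finset.mul_sum]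
  simp only [mul_assoc]; ring

lemma smoothOn_connN (β α : Fin p) (k : Fin 2) : SmoothOn (fr.connN β α k) U :=
  (fr.toTangentFrame.smoothOn_deriv k (fr.smooth_ν β)).inner' (fr.smooth_ν α)

lemma smoothOn_normD (k : Fin 2) {f : Fin p → M → ℝ} (hf : ∀ α, SmoothOn (f α) U) (α : Fin p) :
    SmoothOn (fr.normD k f α) U :=
  (fr.toTangentFrame.smoothOn_deriv k (hf α)).add'
    (SmoothOn.sum' _ fun β _ => (hf β).mul' (fr.smoothOn_connN β α k))

include hx hF in
/-- The normal covariant derivative is the normal part of the derivative of `ℝ^{p+3}`. -/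
lemma normD_inner (k : Fin 2) {s : M → Ambient p} (hs : SmoothOn s U)
    (hn : ∀ y ∈ U, s y ∈ normalSpace F y) (α : Fin p) :
    fr.normD k (fun β y => ⟪s y, fr.ν β y⟫_ℝ) α x =
      ⟪fr.toTangentFrame.deriv k s x, fr.ν α x⟫_ℝ := by
  have hskew : ∀ β, fr.connN β α k x = - ⟪fr.ν β x, fr.toTangentFrame.deriv k (fr.ν α) x⟫_ℝ := by
    intro β
    have := fr.toTangentFrame.deriv_inner_eq_zero hx k (fr.smooth_ν β) (fr.smooth_ν α)
      (fun y hy => orthonormal_iff_ite.1 (fr.orthonormal_ν y hy) β α)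
    exact eq_neg_of_add_eq_zero_left this
  rw [normD, D_eq, fr.toTangentFrame.deriv_inner hx k hs (fr.smooth_ν α)]
  simp only [hskew, mul_neg, Finset.sum_neg_distrib]
  rw [fr.sum_inner_ν_mul hx hF (hn x hx)]
  ring

include hx hF in
/-- The Ricci identity for sections of the normal bundle. -/
lemma normD_comm (hmin : IsMinimal F) {s : M → Ambient p} (hs : SmoothOn s U)
    (hn : ∀ y ∈ U, s y ∈ normalSpace F y) (α : Fin p) :
    fr.normD 0 (fr.normD 1 fun β y => ⟪s y, fr.ν β y⟫_ℝ) α x =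
      fr.normD 1 (fr.normD 0 fun β y => ⟪s y, fr.ν β y⟫_ℝ) α x
      - fr.w 0 x * fr.normD 0 (fun β y => ⟪s y, fr.ν β y⟫_ℝ) α x
      - fr.w 1 x * fr.normD 1 (fun β y => ⟪s y, fr.ν β y⟫_ℝ) α x
      + 2 * ⟪s x, fr.B x⟫_ℝ * ⟪fr.A x, fr.ν α x⟫_ℝ - 2 * ⟪s x, fr.A x⟫_ℝ * ⟪fr.B x, fr.ν α x⟫_ℝ := by
  set t := fr.toTangentFrame with ht
  have sv := t.smoothOn_vec hF
  have hsv : ∀ k i, ∀ y ∈ U, ⟪t.deriv k s y, t.vec i y⟫_ℝ = - ⟪s y, t.deriv k (t.vec i) y⟫_ℝ :=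
    fun k i y hy => eq_neg_of_add_eq_zero_left <|
      t.deriv_inner_eq_zero hy k hs (sv i) (c := 0) fun z hz => by
        rw [real_inner_comm]; exact t.inner_vec_of_mem_normalSpace (hn z hz) i
  have hsP : ∀ k, ∀ y ∈ U, ⟪t.deriv k s y, position F y⟫_ℝ = 0 := fun k y hy => by
    have := t.deriv_inner_eq_zero hy k hs (TangentFrame.smoothOn_position hF) (c := 0) fun z hz => by
        rw [real_inner_comm]; exact inner_position_of_mem_normalSpace (hn z hz)
    rw [t.deriv_position, real_inner_comm (t.vec k y),
      t.inner_vec_of_mem_normalSpace (hn y hy)] at this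
    linarith
  -- The normal part of D_{e_k}s: the Weingarten formula gives the tangential part to remove, and
  -- there is no radial part.
  let N : Fin 2 → M → Ambient p := fun k y => t.deriv k s y
    + ⟪s y, t.deriv k (t.vec 0) y⟫_ℝ • t.vec 0 y + ⟪s y, t.deriv k (t.vec 1) y⟫_ℝ • t.vec 1 y
  have c0 : ∀ k i, SmoothOn (fun y => ⟪s y, t.deriv k (t.vec i) y⟫_ℝ) U := fun k i =>
    hs.inner' (t.smoothOn_deriv k (sv i))
  have sN : ∀ k, SmoothOn (N k) U := fun k =>
    ((t.smoothOn_deriv k hs).add' ((c0 k 0).smul' (sv 0))).add' ((c0 k 1).smul' (sv 1))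
  have nN : ∀ k, ∀ y ∈ U, N k y ∈ normalSpace F y := fun k y hy => by
    refine t.mem_normalSpace hy ?_ fun i => ?_
    · have := hsP k y hy
      rw [real_inner_comm] at this
      simp only [N, inner_add_right, real_inner_smul_right, this, t.inner_position_vec hy hF]
      ring
    · rw [real_inner_comm]
      simp only [N, inner_add_left, real_inner_smul_left, hsv k i y hy, t.inner_vec hy]
      fin_cases i <;> simp
  have hvν : ∀ i, ∀ y ∈ U, ∀ β, ⟪t.vec i y, fr.ν β y⟫_ℝ = 0 := fun i y hy β =>
    fr.inner_vec_ν hy i β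
  have e1 : ∀ k β, ∀ y ∈ U, fr.normD k (fun β y => ⟪s y, fr.ν β y⟫_ℝ) β y = ⟪N k y, fr.ν β y⟫_ℝ := by
    intro k β y hy
    rw [fr.normD_inner hy hF k hs hn]
    simp only [N, inner_add_left, real_inner_smul_left, hvν _ y hy]
    ring
  have e2 : ∀ j k, fr.normD j (fr.normD k fun β y => ⟪s y, fr.ν β y⟫_ℝ) α x =
      ⟪t.deriv j (t.deriv k s) x, fr.ν α x⟫_ℝ
      + ⟪s x, t.deriv k (t.vec 0) x⟫_ℝ * ⟪t.deriv j (t.vec 0) x, fr.ν α x⟫_ℝ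
      + ⟪s x, t.deriv k (t.vec 1) x⟫_ℝ * ⟪t.deriv j (t.vec 1) x, fr.ν α x⟫_ℝ := by
    intro j k
    rw [fr.normD_congr hx j (e1 k), fr.normD_inner hx hF j (sN k) (nN k)]
    rw [t.deriv_add hx j ((t.smoothOn_deriv k hs).add' ((c0 k 0).smul' (sv 0)))
        ((c0 k 1).smul' (sv 1)), t.deriv_add hx j (t.smoothOn_deriv k hs) ((c0 k 0).smul' (sv 0)),
      t.deriv_smul hx j (c0 k 0) (sv 0), t.deriv_smul hx j (c0 k 1) (sv 1)]
    simp only [inner_add_left, real_inner_smul_left, hvν _ x hx]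
    ring
  -- Ambient derivatives commute up to [e₁,e₂]; the normal curvature comes entirely from the
  -- products of second fundamental forms left by the Weingarten terms.
  rw [e2, e2, fr.normD_inner hx hF 0 hs hn, fr.normD_inner hx hF 1 hs hn, t.deriv_comm hx hF hs,
    t.deriv_zero_vec_zero, t.deriv_one_vec_zero, t.deriv_zero_vec_one hx hF,
    t.deriv_one_vec_one hx hF hmin]
  have hsx := hn x hx
  have s0 := t.inner_vec_of_mem_normalSpace hsx 0
  have s1 := t.inner_vec_of_mem_normalSpace hsx 1
  have s2 := inner_position_of_mem_normalSpace hsx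
  rw [real_inner_comm] at s0 s1 s2
  simp only [inner_add_left, inner_sub_left, inner_add_right, inner_sub_right,
    real_inner_smul_left, real_inner_smul_right, hvν _ x hx, s0, s1, s2,
    inner_position_of_mem_normalSpace (fr.normal_ν x hx α)]
  ring

end AdaptedFrame
end
end MinimalSurface

namespace MinimalSurface
noncomputable section

/-! ### Components of h, ∇h and ∇²h reduced by symmetry, trace-freeness and Codazzi. -/

namespace AdaptedFrame

variable {M : Type*} [TopologicalSpace M] [ChartedSpace (EuclideanSpace ℝ (Fin 2)) M]
  [IsManifold (𝓡 2) ∞ M] {p : ℕ} {F : M → UnitSphere p} {U : Set M} (fr : AdaptedFrame F U)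
variable {x : M} (hx : x ∈ U) (hF : IsSmoothImmersion F) (hmin : IsMinimal F)

lemma smoothOn_h (hF : IsSmoothImmersion F) (α : Fin p) (i j : Fin 2) : SmoothOn (fr.h α i j) U :=
  (fr.toTangentFrame.smoothOn_deriv j (fr.smoothOn_vec hF i)).inner' (fr.smooth_ν α)

include hx in
lemma h_zero_zero (α : Fin p) : fr.h α 0 0 x = ⟪fr.A x, fr.ν α x⟫_ℝ := by
  change ⟪fr.toTangentFrame.deriv 0 (fr.vec 0) x, fr.ν α x⟫_ℝ = _
  rw [fr.deriv_zero_vec_zero, inner_sub_left, inner_add_left, real_inner_smul_left,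
    fr.inner_vec_ν hx, inner_position_of_mem_normalSpace (fr.normal_ν x hx α)]
  ring

include hx in
lemma h_zero_one (α : Fin p) : fr.h α 0 1 x = ⟪fr.B x, fr.ν α x⟫_ℝ := by
  change ⟪fr.toTangentFrame.deriv 1 (fr.vec 0) x, fr.ν α x⟫_ℝ = _
  rw [fr.deriv_one_vec_zero, inner_add_left, real_inner_smul_left, fr.inner_vec_ν hx]
  ring

include hx hF

lemma h_one_zero (α : Fin p) : fr.h α 1 0 x = fr.h α 0 1 x := by
  rw [fr.h_zero_one hx]
  change ⟪fr.toTangentFrame.deriv 0 (fr.vec 1) x, fr.ν α x⟫_ℝ = _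
  rw [fr.deriv_zero_vec_one hx hF, inner_add_left, real_inner_smul_left, fr.inner_vec_ν hx]
  ring

include hmin in
lemma h_one_one (α : Fin p) : fr.h α 1 1 x = - fr.h α 0 0 x := by
  rw [fr.h_zero_zero hx]
  change ⟪fr.toTangentFrame.deriv 1 (fr.vec 1) x, fr.ν α x⟫_ℝ = _
  rw [fr.deriv_one_vec_one hx hF hmin, inner_sub_left, inner_sub_left, real_inner_smul_left,
    fr.inner_vec_ν hx, inner_position_of_mem_normalSpace (fr.normal_ν x hx α)]
  ring

lemma connT_eq (i j k : Fin 2) : fr.connT i j k x =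
    if i = j then 0 else if i = 0 then fr.w k x else - fr.w k x :=
  fr.inner_deriv_vec hx hF i j k

lemma connT_zero_zero (k : Fin 2) : fr.connT 0 0 k x = 0 := by simp [fr.connT_eq hx hF]
lemma connT_one_one (k : Fin 2) : fr.connT 1 1 k x = 0 := by simp [fr.connT_eq hx hF]
lemma connT_zero_one (k : Fin 2) : fr.connT 0 1 k x = fr.w k x := by simp [fr.connT_eq hx hF]
lemma connT_one_zero (k : Fin 2) : fr.connT 1 0 k x = - fr.w k x := by simp [fr.connT_eq hx hF]

omit hx hF in
lemma h₁_eq (α : Fin p) (i j k : Fin 2) : fr.h₁ α i j k x =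
    fr.normD k (fun β => fr.h β i j) α x + ∑ m, fr.h α m j x * fr.connT m i k x
      + ∑ m, fr.h α i m x * fr.connT m j k x := by
  rw [h₁, normD]; ring

omit hx hF in
lemma h₂_eq (α : Fin p) (i j k l : Fin 2) : fr.h₂ α i j k l x =
    fr.normD l (fun β => fr.h₁ β i j k) α x + ∑ m, fr.h₁ α m j k x * fr.connT m i l x
      + ∑ m, fr.h₁ α i m k x * fr.connT m j l x + ∑ m, fr.h₁ α i j m x * fr.connT m k l x := by
  rw [h₂, normD]; ring

omit hx hF in
lemma h₃_eq (α : Fin p) (i j k l m : Fin 2) : fr.h₃ α i j k l m x =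
    fr.normD m (fun β => fr.h₂ β i j k l) α x + ∑ n, fr.h₂ α n j k l x * fr.connT n i m x
      + ∑ n, fr.h₂ α i n k l x * fr.connT n j m x + ∑ n, fr.h₂ α i j n l x * fr.connT n k m x
      + ∑ n, fr.h₂ α i j k n x * fr.connT n l m x := by
  rw [h₃, normD]; ring

lemma h₁_zero_zero (α : Fin p) (k : Fin 2) : fr.h₁ α 0 0 k x =
    fr.normD k (fun β => fr.h β 0 0) α x - 2 * fr.w k x * fr.h α 0 1 x := by
  simp only [h₁_eq, Fin.sum_univ_two, fr.connT_zero_zero hx hF, fr.connT_one_zero hx hF,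
    fr.h_one_zero hx hF]
  ring

include hmin

lemma h₁_zero_one (α : Fin p) (k : Fin 2) : fr.h₁ α 0 1 k x =
    fr.normD k (fun β => fr.h β 0 1) α x + 2 * fr.w k x * fr.h α 0 0 x := by
  simp only [h₁_eq, Fin.sum_univ_two, fr.connT_zero_zero hx hF, fr.connT_one_zero hx hF,
    fr.connT_zero_one hx hF, fr.connT_one_one hx hF, fr.h_one_one hx hF hmin]
  ring

lemma h₁_one_zero (α : Fin p) (k : Fin 2) : fr.h₁ α 1 0 k x = fr.h₁ α 0 1 k x := by
  rw [fr.h₁_zero_one hx hF hmin, h₁_eq,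
    fr.normD_congr hx k (fun β y hy => fr.h_one_zero hy hF β)]
  simp only [Fin.sum_univ_two, fr.connT_one_zero hx hF,
    fr.connT_zero_zero hx hF, fr.connT_zero_one hx hF, fr.connT_one_one hx hF,
    fr.h_one_one hx hF hmin]
  ring

lemma h₁_one_one (α : Fin p) (k : Fin 2) : fr.h₁ α 1 1 k x = - fr.h₁ α 0 0 k x := by
  rw [fr.h₁_zero_zero hx hF, h₁_eq,
    fr.normD_congr hx k (fun β y hy => fr.h_one_one hy hF hmin β), normD_neg]
  simp only [Fin.sum_univ_two, fr.h_one_zero hx hF,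
    fr.connT_zero_one hx hF, fr.connT_one_one hx hF]
  ring

omit hmin in
lemma normD_h_zero_zero (α : Fin p) (k : Fin 2) : fr.normD k (fun β => fr.h β 0 0) α x =
    ⟪fr.toTangentFrame.deriv k fr.A x, fr.ν α x⟫_ℝ := by
  rw [fr.normD_congr hx k (fun β y hy => fr.h_zero_zero hy β)]
  exact fr.normD_inner hx hF k (fr.smoothOn_A hF) (fun y hy => fr.A_mem_normalSpace hy hF) α

omit hmin in
lemma normD_h_zero_one (α : Fin p) (k : Fin 2) : fr.normD k (fun β => fr.h β 0 1) α x =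
    ⟪fr.toTangentFrame.deriv k fr.B x, fr.ν α x⟫_ℝ := by
  rw [fr.normD_congr hx k (fun β y hy => fr.h_zero_one hy β)]
  exact fr.normD_inner hx hF k (fr.smoothOn_B hF) (fun y hy => fr.B_mem_normalSpace hy hF) α

/-- The normal component of the first Codazzi equation; with the second, it makes ∇h totally
symmetric and trace-free, with only h₁₁₁ and h₁₁₂ independent. -/
lemma h₁_zero_one_zero (α : Fin p) : fr.h₁ α 0 1 0 x = fr.h₁ α 0 0 1 x := by
  have h := congrArg (fun z => ⟪z, fr.ν α x⟫_ℝ) (fr.codazzi_zero hx hF hmin)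
  simp only [inner_add_left, inner_sub_left, real_inner_smul_left, fr.inner_vec_ν hx] at h
  rw [fr.h₁_zero_one hx hF hmin, fr.h₁_zero_zero hx hF, fr.normD_h_zero_zero hx hF,
    fr.normD_h_zero_one hx hF, fr.h_zero_one hx, fr.h_zero_zero hx]
  linear_combination h

lemma h₁_zero_one_one (α : Fin p) : fr.h₁ α 0 1 1 x = - fr.h₁ α 0 0 0 x := by
  have h := congrArg (fun z => ⟪z, fr.ν α x⟫_ℝ) (fr.codazzi_one hx hF hmin)
  simp only [inner_add_left, inner_sub_left, real_inner_smul_left, fr.inner_vec_ν hx] at h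
  rw [fr.h₁_zero_one hx hF hmin, fr.h₁_zero_zero hx hF, fr.normD_h_zero_zero hx hF,
    fr.normD_h_zero_one hx hF, fr.h_zero_one hx, fr.h_zero_zero hx]
  linear_combination h

/-- A symmetric trace-free 3-tensor in the plane has two components, which the connection rotates
into each other; the factor 3 is the number of indices. -/
lemma h₂_zero_zero_zero (α : Fin p) (l : Fin 2) : fr.h₂ α 0 0 0 l x =
    fr.normD l (fun β => fr.h₁ β 0 0 0) α x - 3 * fr.w l x * fr.h₁ α 0 0 1 x := by
  rw [h₂_eq]
  simp only [Fin.sum_univ_two, fr.connT_zero_zero hx hF, fr.connT_one_zero hx hF,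
    fr.h₁_one_zero hx hF hmin, fr.h₁_zero_one_zero hx hF hmin]
  ring

lemma h₂_zero_zero_one (α : Fin p) (l : Fin 2) : fr.h₂ α 0 0 1 l x =
    fr.normD l (fun β => fr.h₁ β 0 0 1) α x + 3 * fr.w l x * fr.h₁ α 0 0 0 x := by
  rw [h₂_eq]
  simp only [Fin.sum_univ_two, fr.connT_zero_zero hx hF, fr.connT_one_zero hx hF,
    fr.connT_zero_one hx hF, fr.connT_one_one hx hF,
    fr.h₁_one_zero hx hF hmin, fr.h₁_zero_one_one hx hF hmin]
  ring

lemma h₂_zero_one_zero (α : Fin p) (l : Fin 2) : fr.h₂ α 0 1 0 l x = fr.h₂ α 0 0 1 l x := by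
  rw [fr.h₂_zero_zero_one hx hF hmin, h₂_eq,
    fr.normD_congr hx l (fun β y hy => fr.h₁_zero_one_zero hy hF hmin β)]
  simp only [Fin.sum_univ_two, fr.connT_zero_zero hx hF, fr.connT_one_zero hx hF,
    fr.connT_zero_one hx hF, fr.connT_one_one hx hF, fr.h₁_one_one hx hF hmin,
    fr.h₁_zero_one_one hx hF hmin]
  ring

lemma h₂_zero_one_one (α : Fin p) (l : Fin 2) : fr.h₂ α 0 1 1 l x = - fr.h₂ α 0 0 0 l x := by
  rw [fr.h₂_zero_zero_zero hx hF hmin, h₂_eq,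
    fr.normD_congr hx l (fun β y hy => fr.h₁_zero_one_one hy hF hmin β), normD_neg]
  simp only [Fin.sum_univ_two, fr.connT_zero_zero hx hF, fr.connT_one_zero hx hF,
    fr.connT_zero_one hx hF, fr.connT_one_one hx hF, fr.h₁_one_one hx hF hmin,
    fr.h₁_zero_one_zero hx hF hmin]
  ring

lemma h₂_one_zero (α : Fin p) (k l : Fin 2) : fr.h₂ α 1 0 k l x = fr.h₂ α 0 1 k l x := by
  rw [h₂_eq, h₂_eq, fr.normD_congr hx l (fun β y hy => fr.h₁_one_zero hy hF hmin β k)]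
  simp only [Fin.sum_univ_two, fr.h₁_one_zero hx hF hmin]
  ring

omit hx hmin in
lemma smoothOn_h₁_zero_zero (α : Fin p) (k : Fin 2) : SmoothOn (fr.h₁ α 0 0 k) U := by
  have s : SmoothOn (fun y => fr.normD k (fun β => fr.h β 0 0) α y - 2 * fr.w k y * fr.h α 0 1 y) U :=
    (fr.smoothOn_normD k (fun β => fr.smoothOn_h hF β 0 0) α).sub'
      (((smoothOn_const 2).mul' (fr.smoothOn_w hF k)).mul' (fr.smoothOn_h hF α 0 1))
  exact s.congr fun y hy => fr.h₁_zero_zero hy hF α k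

omit hx in
lemma smoothOn_h₂_zero_zero_zero (α : Fin p) (l : Fin 2) : SmoothOn (fr.h₂ α 0 0 0 l) U := by
  have s : SmoothOn (fun y => fr.normD l (fun β => fr.h₁ β 0 0 0) α y
      - 3 * fr.w l y * fr.h₁ α 0 0 1 y) U :=
    (fr.smoothOn_normD l (fun β => fr.smoothOn_h₁_zero_zero hF β 0) α).sub'
      (((smoothOn_const 3).mul' (fr.smoothOn_w hF l)).mul' (fr.smoothOn_h₁_zero_zero hF α 1))
  exact s.congr fun y hy => fr.h₂_zero_zero_zero hy hF hmin α l

omit hx in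
lemma smoothOn_h₂_zero_zero_one (α : Fin p) (l : Fin 2) : SmoothOn (fr.h₂ α 0 0 1 l) U := by
  have s : SmoothOn (fun y => fr.normD l (fun β => fr.h₁ β 0 0 1) α y
      + 3 * fr.w l y * fr.h₁ α 0 0 0 y) U :=
    (fr.smoothOn_normD l (fun β => fr.smoothOn_h₁_zero_zero hF β 1) α).add'
      (((smoothOn_const 3).mul' (fr.smoothOn_w hF l)).mul' (fr.smoothOn_h₁_zero_zero hF α 0))
  exact s.congr fun y hy => fr.h₂_zero_zero_one hy hF hmin α l

omit hmin in
/-- Covariant derivatives of the combinations of `h`, with their connection terms. -/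
lemma normD_combination {f g : Fin p → M → ℝ} (k m : Fin 2) (hf : ∀ α, SmoothOn (f α) U)
    (hg : ∀ α, SmoothOn (g α) U) (c : ℝ) (α : Fin p) :
    fr.normD m (fun β y => f β y + c * fr.w k y * g β y) α x = fr.normD m f α x
      + c * (fr.w k x * fr.normD m g α x + fr.D m (fr.w k) x * g α x) := by
  have hw : SmoothOn (fun y => c * fr.w k y) U := (smoothOn_const c).mul' (fr.smoothOn_w hF k)
  rw [fr.normD_add hx m hf (g := fun β y => c * fr.w k y * g β y) (fun β => hw.mul' (hg β)),
    fr.normD_mul hx m hw hg]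
  have : fr.D m (fun y => c * fr.w k y) x = c * fr.D m (fr.w k) x :=
    fr.toTangentFrame.deriv_const_mul hx m c (fr.smoothOn_w hF k)
  rw [this]; ring

end AdaptedFrame
end
end MinimalSurface

namespace MinimalSurface
noncomputable section

/-! ### Simons' identity when the Hopf differential vanishes, its derivative, and the final bound.
-/

namespace AdaptedFrame

variable {M : Type*} [TopologicalSpace M] [ChartedSpace (EuclideanSpace ℝ (Fin 2)) M]
  [IsManifold (𝓡 2) ∞ M] {p : ℕ} {F : M → UnitSphere p} {U : Set M} (fr : AdaptedFrame F U)
variable {x : M} (hx : x ∈ U) (hF : IsSmoothImmersion F) (hmin : IsMinimal F)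

include hx hF

lemma sum_h_zero_zero_sq : ∑ α, fr.h α 0 0 x ^ 2 = ⟪fr.A x, fr.A x⟫_ℝ := by
  rw [← fr.sum_inner_ν_mul hx hF (fr.A_mem_normalSpace hx hF)]
  refine Finset.sum_congr rfl fun α _ => ?_
  rw [fr.h_zero_zero hx, real_inner_comm (fr.A x) (fr.ν α x), sq]

lemma sum_h_zero_one_sq : ∑ α, fr.h α 0 1 x ^ 2 = ⟪fr.B x, fr.B x⟫_ℝ := by
  rw [← fr.sum_inner_ν_mul hx hF (fr.B_mem_normalSpace hx hF)]
  refine Finset.sum_congr rfl fun α _ => ?_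
  rw [fr.h_zero_one hx, real_inner_comm (fr.B x) (fr.ν α x), sq]

lemma sum_h_mul_h : ∑ α, fr.h α 0 0 x * fr.h α 0 1 x = ⟪fr.A x, fr.B x⟫_ℝ := by
  rw [← fr.sum_inner_ν_mul hx hF (fr.A_mem_normalSpace hx hF)]
  refine Finset.sum_congr rfl fun α _ => ?_
  rw [fr.h_zero_zero hx, fr.h_zero_one hx, real_inner_comm (fr.B x) (fr.ν α x)]

include hmin

lemma S_eq : fr.S x = 2 * ⟪fr.A x, fr.A x⟫_ℝ + 2 * ⟪fr.B x, fr.B x⟫_ℝ := by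
  rw [← fr.sum_h_zero_zero_sq hx hF, ← fr.sum_h_zero_one_sq hx hF, Finset.mul_sum, Finset.mul_sum,
    ← Finset.sum_add_distrib, S]
  refine Finset.sum_congr rfl fun α _ => ?_
  simp only [Fin.sum_univ_two, fr.h_one_zero hx hF, fr.h_one_one hx hF hmin]
  ring

omit hx in
lemma smoothOn_S : SmoothOn fr.S U := by
  have s : SmoothOn (fun y => 2 * ⟪fr.A y, fr.A y⟫_ℝ + 2 * ⟪fr.B y, fr.B y⟫_ℝ) U :=
    ((smoothOn_const 2).mul' ((fr.smoothOn_A hF).inner' (fr.smoothOn_A hF))).add'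
      ((smoothOn_const 2).mul' ((fr.smoothOn_B hF).inner' (fr.smoothOn_B hF)))
  exact s.congr fun y hy => fr.S_eq hy hF hmin

variable (hQ : ∀ y ∈ U, fr.hopfSq y = 0)
include hQ

omit hF hmin in
lemma inner_A_B : ⟪fr.A x, fr.B x⟫_ℝ = 0 := by
  have h := hQ x hx
  unfold TangentFrame.hopfSq at h
  have : fr.hopfIm x = 0 := by nlinarith [sq_nonneg (fr.hopfRe x), sq_nonneg (fr.hopfIm x)]
  simpa [TangentFrame.hopfIm] using this

omit hF hmin in
lemma inner_B_B : ⟪fr.B x, fr.B x⟫_ℝ = ⟪fr.A x, fr.A x⟫_ℝ := by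
  have h := hQ x hx
  unfold TangentFrame.hopfSq at h
  have : fr.hopfRe x = 0 := by nlinarith [sq_nonneg (fr.hopfRe x), sq_nonneg (fr.hopfIm x)]
  rw [TangentFrame.hopfRe] at this
  linarith

/-- The Laplacian of `h` of a superminimal surface. -/
lemma h₂_zero_zero_add (α : Fin p) :
    fr.h₂ α 0 0 0 0 x + fr.h₂ α 0 0 1 1 x = (2 - 3 / 2 * fr.S x) * fr.h α 0 0 x := by
  have hu : ∀ α, SmoothOn (fr.h α 0 0) U := fun α => fr.smoothOn_h hF α 0 0
  have hv : ∀ α, SmoothOn (fr.h α 0 1) U := fun α => fr.smoothOn_h hF α 0 1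
  have sn : ∀ k α, SmoothOn (fr.normD k (fun β => fr.h β 0 1) α) U := fun k =>
    fr.smoothOn_normD k hv
  -- Codazzi rewrites h₁₁₁ and h₁₁₂ through derivatives of h₁₂, so the Laplacian of h₁₁ becomes a
  -- commutator on h₁₂. It equals 2K - 2|A|² times h₁₁, where K = 1 - S/2 and |A|² = S/4; hence 2 -
  -- 3S/2.
  have e1 : ∀ β, ∀ y ∈ U, fr.h₁ β 0 0 0 y =
      - fr.normD 1 (fun β => fr.h β 0 1) β y + (-2) * fr.w 1 y * fr.h β 0 0 y := fun β y hy => by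
    have h1 := fr.h₁_zero_one_one hy hF hmin β
    rw [fr.h₁_zero_one hy hF hmin] at h1
    linarith
  have e2 : ∀ β, ∀ y ∈ U, fr.h₁ β 0 0 1 y =
      fr.normD 0 (fun β => fr.h β 0 1) β y + 2 * fr.w 0 y * fr.h β 0 0 y := fun β y hy => by
    rw [← fr.h₁_zero_one_zero hy hF hmin, fr.h₁_zero_one hy hF hmin]
  have e3 := fr.h₁_zero_zero hx hF α 0
  have e4 := fr.h₁_zero_zero hx hF α 1
  have e5 := e1 α x hx
  have e6 := e2 α x hx
  have hc : fr.normD 0 (fr.normD 1 fun β => fr.h β 0 1) α x =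
      fr.normD 1 (fr.normD 0 fun β => fr.h β 0 1) α x
      - fr.w 0 x * fr.normD 0 (fun β => fr.h β 0 1) α x
      - fr.w 1 x * fr.normD 1 (fun β => fr.h β 0 1) α x
      + 2 * ⟪fr.A x, fr.A x⟫_ℝ * fr.h α 0 0 x := by
    have h := fr.normD_comm hx hF hmin (fr.smoothOn_B hF)
      (fun y hy => fr.B_mem_normalSpace hy hF) α
    have hvB : ∀ β, ∀ y ∈ U, fr.h β 0 1 y = ⟪fr.B y, fr.ν β y⟫_ℝ := fun β y hy =>
      fr.h_zero_one hy β
    rw [← fr.h_zero_zero hx, ← fr.h_zero_one hx, real_inner_comm (fr.A x) (fr.B x),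
      fr.inner_A_B hx hQ, fr.inner_B_B hx hQ, ← fr.normD_congr hx 0 hvB, ← fr.normD_congr hx 1 hvB,
      ← fr.normD_congr hx 0 (fun β y hy => fr.normD_congr hy 1 hvB β),
      ← fr.normD_congr hx 1 (fun β y hy => fr.normD_congr hy 0 hvB β)] at h
    rw [h]; ring
  have hK := fr.gaussCurvature_eq hx hF
  rw [fr.gauss hx hF hmin, fr.inner_B_B hx hQ] at hK
  have hS := fr.S_eq hx hF hmin
  rw [fr.inner_B_B hx hQ] at hS
  rw [fr.h₂_zero_zero_zero hx hF hmin, fr.h₂_zero_zero_one hx hF hmin, fr.normD_congr hx 0 e1,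
    fr.normD_congr hx 1 e2, fr.normD_combination hx hF 1 0 (fun β => (sn 1 β).neg') hu,
    fr.normD_combination hx hF 0 1 (sn 0) hu, normD_neg, hc, hS]
  simp only [D_eq]
  linear_combination (2 * fr.w 1 x) * e3 - 2 * fr.w 0 x * e4 + fr.w 1 x * e5 - fr.w 0 x * e6
    - 2 * fr.h α 0 0 x * hK

/-- The companion identity for Δh₁₂: by Codazzi its Laplacian is the commutator of second
derivatives of h₁₁, with the same curvature factor. -/
lemma h₂_zero_zero_sub (α : Fin p) :
    fr.h₂ α 0 0 1 0 x - fr.h₂ α 0 0 0 1 x = (2 - 3 / 2 * fr.S x) * fr.h α 0 1 x := by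
  have hu : ∀ α, SmoothOn (fr.h α 0 0) U := fun α => fr.smoothOn_h hF α 0 0
  have hv : ∀ α, SmoothOn (fr.h α 0 1) U := fun α => fr.smoothOn_h hF α 0 1
  have sn : ∀ k α, SmoothOn (fr.normD k (fun β => fr.h β 0 0) α) U := fun k =>
    fr.smoothOn_normD k hu
  have e1 : ∀ k β, ∀ y ∈ U, fr.h₁ β 0 0 k y =
      fr.normD k (fun β => fr.h β 0 0) β y + (-2) * fr.w k y * fr.h β 0 1 y := fun k β y hy => by
    rw [fr.h₁_zero_zero hy hF]; ring
  have e3 := e1 0 α x hx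
  have e4 := e1 1 α x hx
  have e5 := fr.h₁_zero_one_one hx hF hmin α
  have e6 := fr.h₁_zero_one_zero hx hF hmin α
  rw [fr.h₁_zero_one hx hF hmin] at e5 e6
  have hc : fr.normD 0 (fr.normD 1 fun β => fr.h β 0 0) α x =
      fr.normD 1 (fr.normD 0 fun β => fr.h β 0 0) α x
      - fr.w 0 x * fr.normD 0 (fun β => fr.h β 0 0) α x
      - fr.w 1 x * fr.normD 1 (fun β => fr.h β 0 0) α x
      - 2 * ⟪fr.A x, fr.A x⟫_ℝ * fr.h α 0 1 x := by
    have h := fr.normD_comm hx hF hmin (fr.smoothOn_A hF)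
      (fun y hy => fr.A_mem_normalSpace hy hF) α
    have huA : ∀ β, ∀ y ∈ U, fr.h β 0 0 y = ⟪fr.A y, fr.ν β y⟫_ℝ := fun β y hy =>
      fr.h_zero_zero hy β
    rw [← fr.h_zero_zero hx, ← fr.h_zero_one hx, fr.inner_A_B hx hQ,
      ← fr.normD_congr hx 0 huA, ← fr.normD_congr hx 1 huA,
      ← fr.normD_congr hx 0 (fun β y hy => fr.normD_congr hy 1 huA β),
      ← fr.normD_congr hx 1 (fun β y hy => fr.normD_congr hy 0 huA β)] at h
    rw [h]; ring
  have hK := fr.gaussCurvature_eq hx hF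
  rw [fr.gauss hx hF hmin, fr.inner_B_B hx hQ] at hK
  have hS := fr.S_eq hx hF hmin
  rw [fr.inner_B_B hx hQ] at hS
  rw [fr.h₂_zero_zero_zero hx hF hmin, fr.h₂_zero_zero_one hx hF hmin, fr.normD_congr hx 0 (e1 1),
    fr.normD_congr hx 1 (e1 0), fr.normD_combination hx hF 1 0 (sn 1) hv,
    fr.normD_combination hx hF 0 1 (sn 0) hv, hc, hS]
  simp only [D_eq]
  linear_combination fr.w 0 x * e3 + fr.w 1 x * e4 + 2 * fr.w 0 x * e5 - 2 * fr.w 1 x * e6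
    - 2 * fr.h α 0 1 x * hK

omit hQ in
lemma normD_const_sub_S_mul {f : Fin p → M → ℝ} (hf : ∀ α, SmoothOn (f α) U) (m : Fin 2)
    (α : Fin p) : fr.normD m (fun β y => (2 - 3 / 2 * fr.S y) * f β y) α x =
      (2 - 3 / 2 * fr.S x) * fr.normD m f α x - 3 / 2 * fr.D m fr.S x * f α x := by
  have hS := fr.smoothOn_S hF hmin
  have e : fr.normD m (fun β y => (2 - 3 / 2 * fr.S y) * f β y) α x =
      fr.normD m (fun β y => 2 * f β y - 3 / 2 * fr.S y * f β y) α x :=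
    fr.normD_congr hx m (fun β y _ => by ring) α
  have s : SmoothOn (fun y => 3 / 2 * fr.S y) U := (smoothOn_const _).mul' hS
  rw [e, fr.normD_sub hx m (fun β => (smoothOn_const 2).mul' (hf β)) (fun β => s.mul' (hf β)),
    fr.normD_mul hx m s hf, fr.normD_mul hx m (smoothOn_const 2) hf]
  have h1 : fr.D m (fun y => 3 / 2 * fr.S y) x = 3 / 2 * fr.D m fr.S x :=
    fr.toTangentFrame.deriv_const_mul hx m _ hS
  have h2 : fr.D m (fun _ => (2 : ℝ)) x = 0 := by
    simp only [D, dirDeriv, mfderiv_const]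
    rfl
  rw [h1, h2]; ring

/-- The derivative of the identity Δh₁₁ = (2 - 3S/2)h₁₁. The connection mixes Δh₁₁ and Δh₁₂ exactly
as it mixes h₁₁ and h₁₂, so the undifferentiated identity for Δh₁₂ cancels the connection terms. -/
lemma h₃_zero_zero_add (α : Fin p) (m : Fin 2) :
    fr.h₃ α 0 0 0 0 m x + fr.h₃ α 0 0 1 1 m x =
      (2 - 3 / 2 * fr.S x) * fr.h₁ α 0 0 m x - 3 / 2 * fr.D m fr.S x * fr.h α 0 0 x := by
  have hs := fr.h₂_zero_zero_sub hx hF hmin hQ α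
  have hd := fr.normD_add hx m (fun β => fr.smoothOn_h₂_zero_zero_zero hF hmin β 0)
    (fun β => fr.smoothOn_h₂_zero_zero_one hF hmin β 1) α
  rw [fr.normD_congr hx m (fun β y hy => fr.h₂_zero_zero_add hy hF hmin hQ β),
    fr.normD_const_sub_S_mul hx hF hmin (fun β => fr.smoothOn_h hF β 0 0)] at hd
  simp only [h₃_eq, Fin.sum_univ_two, fr.connT_zero_zero hx hF, fr.connT_one_zero hx hF,
    fr.connT_zero_one hx hF, fr.connT_one_one hx hF, fr.h₂_one_zero hx hF hmin,
    fr.h₂_zero_one_zero hx hF hmin, fr.h₂_zero_one_one hx hF hmin, fr.h₁_zero_zero hx hF]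
  linear_combination -hd - 2 * fr.w m x * hs

lemma h₃_zero_zero_sub (α : Fin p) (m : Fin 2) :
    fr.h₃ α 0 0 1 0 m x - fr.h₃ α 0 0 0 1 m x =
      (2 - 3 / 2 * fr.S x) * fr.h₁ α 0 1 m x - 3 / 2 * fr.D m fr.S x * fr.h α 0 1 x := by
  have hs := fr.h₂_zero_zero_add hx hF hmin hQ α
  have hd := fr.normD_sub hx m (fun β => fr.smoothOn_h₂_zero_zero_one hF hmin β 0)
    (fun β => fr.smoothOn_h₂_zero_zero_zero hF hmin β 1) α
  rw [fr.normD_congr hx m (fun β y hy => fr.h₂_zero_zero_sub hy hF hmin hQ β),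
    fr.normD_const_sub_S_mul hx hF hmin (fun β => fr.smoothOn_h hF β 0 1)] at hd
  simp only [h₃_eq, Fin.sum_univ_two, fr.connT_zero_zero hx hF, fr.connT_one_zero hx hF,
    fr.connT_zero_one hx hF, fr.connT_one_one hx hF, fr.h₂_one_zero hx hF hmin,
    fr.h₂_zero_one_zero hx hF hmin, fr.h₂_zero_one_one hx hF hmin, fr.h₁_zero_one hx hF hmin]
  linear_combination -hd + 2 * fr.w m x * hs

/-- The bound for surfaces whose Hopf differential vanishes. -/
theorem C₂_add_C₃_ge : 9 / 8 * fr.S x * fr.gradSqS x ≤ fr.C₂ x + fr.C₃ x := by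
  have hA : ∑ α, fr.h α 0 0 x ^ 2 = fr.S x / 4 := by
    rw [fr.sum_h_zero_zero_sq hx hF, fr.S_eq hx hF hmin, fr.inner_B_B hx hQ]; ring
  have hB : ∑ α, fr.h α 0 1 x ^ 2 = fr.S x / 4 := by
    rw [fr.sum_h_zero_one_sq hx hF, fr.S_eq hx hF hmin, fr.inner_B_B hx hQ]; ring
  have hAB : ∑ α, fr.h α 0 0 x * fr.h α 0 1 x = 0 := by
    rw [fr.sum_h_mul_h hx hF, fr.inner_A_B hx hQ]
  -- The estimate already holds for each normal component, because (S₁u + S₂v)² + (S₁v - S₂u)² =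
  -- (S₁² + S₂²)(u² + v²).
  have key : ∀ α, 9 / 4 * (fr.D 0 fr.S x ^ 2 + fr.D 1 fr.S x ^ 2)
      * (fr.h α 0 0 x ^ 2 + fr.h α 0 1 x ^ 2) ≤
      2 * (fr.h₃ α 0 0 0 0 0 x - fr.h₃ α 0 0 0 1 1 x) ^ 2
      + 2 * (fr.h₃ α 0 0 1 0 0 x - fr.h₃ α 0 0 1 1 1 x) ^ 2
      + (2 * (fr.h₃ α 0 0 0 0 1 x + fr.h₃ α 0 0 0 1 0 x) ^ 2
      + 2 * (fr.h₃ α 0 0 1 0 1 x + fr.h₃ α 0 0 1 1 0 x) ^ 2) := by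
    intro α
    have a0 := fr.h₃_zero_zero_add hx hF hmin hQ α 0
    have a1 := fr.h₃_zero_zero_add hx hF hmin hQ α 1
    have b0 := fr.h₃_zero_zero_sub hx hF hmin hQ α 0
    have b1 := fr.h₃_zero_zero_sub hx hF hmin hQ α 1
    rw [fr.h₁_zero_one_zero hx hF hmin] at b0
    rw [fr.h₁_zero_one_one hx hF hmin] at b1
    -- A term of 𝒞₂ is paired with one of 𝒞₃ so that the ∇h terms cancel by h₁₂₂ = -h₁₁₁ here and by
    -- h₁₂₁ = h₁₁₂ in `x2`.
    have x1 : (fr.h₃ α 0 0 0 0 0 x - fr.h₃ α 0 0 0 1 1 x)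
        + (fr.h₃ α 0 0 1 0 1 x + fr.h₃ α 0 0 1 1 0 x) =
        -(3 / 2) * (fr.D 0 fr.S x * fr.h α 0 0 x + fr.D 1 fr.S x * fr.h α 0 1 x) := by
      linear_combination a0 + b1
    have x2 : (fr.h₃ α 0 0 1 0 0 x - fr.h₃ α 0 0 1 1 1 x)
        - (fr.h₃ α 0 0 0 0 1 x + fr.h₃ α 0 0 0 1 0 x) =
        -(3 / 2) * (fr.D 0 fr.S x * fr.h α 0 1 x - fr.D 1 fr.S x * fr.h α 0 0 x) := by
      linear_combination b0 - a1
    have y1 := congrArg (· ^ 2) x1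
    have y2 := congrArg (· ^ 2) x2
    -- From 2X² + 2Y² = (X + Y)² + (X - Y)², dropping the square whose value is not known.
    linarith [sq_nonneg ((fr.h₃ α 0 0 0 0 0 x - fr.h₃ α 0 0 0 1 1 x)
        - (fr.h₃ α 0 0 1 0 1 x + fr.h₃ α 0 0 1 1 0 x)),
      sq_nonneg ((fr.h₃ α 0 0 1 0 0 x - fr.h₃ α 0 0 1 1 1 x)
        + (fr.h₃ α 0 0 0 0 1 x + fr.h₃ α 0 0 0 1 0 x))]
  have hsum := Finset.sum_le_sum fun α (_ : α ∈ Finset.univ) => key α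
  rw [← Finset.mul_sum, Finset.sum_add_distrib, hA, hB] at hsum
  simp only [C₂, C₃, EuclideanSpace.real_norm_sq_eq, gradSqS, Fin.sum_univ_two, Finset.mul_sum,
    ← Finset.sum_add_distrib]
  refine le_trans (le_of_eq ?_) hsum
  ring

end AdaptedFrame
end
end MinimalSurface

theorem mainTheorem6 {M : Type*} [TopologicalSpace M] [T2Space M] [CompactSpace M]
    [ChartedSpace (EuclideanSpace ℝ (Fin 2)) M] [IsManifold (𝓡 2) ∞ M] {p : ℕ}
    (F : M → MinimalSurface.UnitSphere p)
    (hF : MinimalSurface.IsSmoothImmersion F)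
    (hmin : MinimalSurface.IsMinimal F)
    (hK : MinimalSurface.HasPositiveGaussCurvature F)
    (U : Set M) (fr : MinimalSurface.AdaptedFrame F U) (x : M) (hx : x ∈ U) :
    fr.C₂ x + fr.C₃ x ≥ 9 / 8 * fr.S x * fr.gradSqS x := by
  exact fr.C₂_add_C₃_ge hx hF hmin fun _ hy =>
    fr.toTangentFrame.hopfSq_eq_zero hF hmin hK hy
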